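/- Let $Q$ be a probability distribution on the real line with $\int x\,Q(dx)=0$, $\int x^2\,Q(dx)=1/2$ and $\int x^4\,Q(dx)<\infty$. Let $(X_{ii}/\sqrt2)_{i\in\mathbb N}$, $(X^{\mathrm{Re}}_{ij})_{i<j}$ and $(X^{\mathrm{Im}}_{ij})_{i<j}$ be jointly independent real random variables with distribution $Q$ on some probability space, put $X_{ij}:=X^{\mathrm{Re}}_{ij}+\mathrm{i}X^{\mathrm{Im}}_{ij}$ and $X_{ji}:=X^{\mathrm{Re}}_{ij}-\mathrm{i}X^{\mathrm{Im}}_{ij}$ for $i<j$, and let $X_N:=(X_{ij})_{1\le i,j\le N}$ be the Hermitian Wigner matrix of size $N$. Let $\xi\in(-2,2)$ and $\mu,\nu\in\mathbb R$, let $\varrho(\xi):=\frac1{2\pi}\sqrt{4-\xi^2}$, and for $\eta\in\mathbb R$ put $$D_N(\xi,\eta):=\det\Big(X_N-\Big(\sqrt N\,\xi+\frac{\eta}{\sqrt N\,\varrho(\xi)}\Big)I_N\Big),\qquad \widetilde D_N(\xi,\eta):=D_N(\xi,\eta)-\mathbb E D_N(\xi,\eta).$$ Then $D_N(\xi,\mu)$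 and $D_N(\xi,\nu)$ are square-integrable for all $N$, the variances $\mathbb E\widetilde D_N(\xi,\mu)^2$ and $\mathbb E\widetilde D_N(\xi,\nu)^2$ are positive for all sufficiently large $N$, and $$\lim_{N\to\infty}\frac{\mathbb E\big(\widetilde D_N(\xi,\mu)\,\widetilde D_N(\xi,\nu)\big)}{\sqrt{\mathbb E\widetilde D_N(\xi,\mu)^2}\,\sqrt{\mathbb E\widetilde D_N(\xi,\nu)^2}}=\frac{\sin\pi(\mu-\nu)}{\pi(\mu-\nu)},$$ where $\frac{\sin 0}{0}:=1$. -/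

import Mathlib

open MeasureTheory ProbabilityTheory Filter Topology

/-- The moment conditions on the (probability) distribution `Q` on the real line: mean zero,
second moment `1/2`, finite fourth moment. Finiteness of the fourth moment makes the first
two integrals converge. -/
structure WignerMoments (Q : Measure ℝ) : Prop where
  integrable_pow_four : Integrable (fun x : ℝ => x ^ 4) Q
  mean : ∫ x, x ∂Q = 0
  second_moment : ∫ x, x ^ 2 ∂Q = 1 / 2

/-- Index pairs strictly above the diagonal. -/
abbrev UpperPair : Type := {p : ℕ × ℕ // p.1 < p.2}

/-- The real random variables that make up an infinite array `X` of complex random variables: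
the normalized diagonal entries `X i i / √2`, and the real and the imaginary parts of the
entries above the diagonal. -/
noncomputable def wignerComponent {Ω : Type*} (X : ℕ → ℕ → Ω → ℂ) :
    ℕ ⊕ (UpperPair ⊕ UpperPair) → Ω → ℝ
  | Sum.inl i => fun ω => (X i i ω).re / √2
  | Sum.inr (Sum.inl p) => fun ω => (X p.1.1 p.1.2 ω).re
  | Sum.inr (Sum.inr p) => fun ω => (X p.1.1 p.1.2 ω).im

/-- `X` is an infinite Hermitian array whose components (see `wignerComponent`) are jointly
independent random variables, each with distribution `Q`. Rows and columns are numbered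
from `0`. The field `hermitian` with `i = j` says that the diagonal entries are real. -/
structure IsWignerArray {Ω : Type*} [MeasurableSpace Ω] (Q : Measure ℝ) (P : Measure Ω)
    (X : ℕ → ℕ → Ω → ℂ) : Prop where
  hermitian : ∀ i j ω, X j i ω = star (X i j ω)
  measurable : ∀ k, Measurable (wignerComponent X k)
  law : ∀ k, P.map (wignerComponent X k) = Q
  indep : iIndepFun (wignerComponent X) P

/-- The `N × N` upper left corner of the array. -/
def wignerMatrix {Ω : Type*} (X : ℕ → ℕ → Ω → ℂ) (N : ℕ) (ω : Ω) :
    Matrix (Fin N) (Fin N) ℂ :=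
  Matrix.of fun i j => X i j ω

/-- The density of the semicircle law at `ξ ∈ (-2, 2)`. -/
noncomputable def semicircleDensity (ξ : ℝ) : ℝ := 1 / (2 * Real.pi) * √(4 - ξ ^ 2)

/-- The point `√N ξ + η / (√N ϱ(ξ))`. -/
noncomputable def spectralPoint (N : ℕ) (ξ η : ℝ) : ℝ :=
  √(N : ℝ) * ξ + η / (√(N : ℝ) * semicircleDensity ξ)

/-- `D_N(ξ, η) = det (X_N - (√N ξ + η / (√N ϱ(ξ))) I_N)`, as a real random variable. The
determinant is real for a Hermitian array (see `charDet_eq_det`), so that taking the real part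
only changes the type. -/
noncomputable def charDet {Ω : Type*} (X : ℕ → ℕ → Ω → ℂ) (N : ℕ) (ξ η : ℝ) (ω : Ω) : ℝ :=
  (wignerMatrix X N ω - ((spectralPoint N ξ η : ℝ) : ℂ) • (1 : Matrix (Fin N) (Fin N) ℂ)).det.re

theorem charDet_eq_det {Ω : Type*} [MeasurableSpace Ω] {Q : Measure ℝ} {P : Measure Ω}
    {X : ℕ → ℕ → Ω → ℂ} (hX : IsWignerArray Q P X) (N : ℕ) (ξ η : ℝ) (ω : Ω) :
    ((charDet X N ξ η ω : ℝ) : ℂ) =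
      (wignerMatrix X N ω -
        ((spectralPoint N ξ η : ℝ) : ℂ) • (1 : Matrix (Fin N) (Fin N) ℂ)).det := by
  set A := wignerMatrix X N ω -
    ((spectralPoint N ξ η : ℝ) : ℂ) • (1 : Matrix (Fin N) (Fin N) ℂ) with hA
  have hW : (wignerMatrix X N ω).conjTranspose = wignerMatrix X N ω := by
    ext i j
    simp [wignerMatrix, Matrix.conjTranspose_apply, hX.hermitian (j : ℕ) (i : ℕ) ω]
  have hAh : A.conjTranspose = A := by
    rw [hA, Matrix.conjTranspose_sub, hW, Matrix.conjTranspose_smul, Matrix.conjTranspose_one]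
    simp
  have hdet : star A.det = A.det := by
    rw [← Matrix.det_conjTranspose, hAh]
  exact Complex.conj_eq_iff_re.mp hdet

/-- The centered characteristic polynomial `D_N(ξ, η) - 𝔼 D_N(ξ, η)`. -/
noncomputable def centeredCharDet {Ω : Type*} [MeasurableSpace Ω] (P : Measure Ω)
    (X : ℕ → ℕ → Ω → ℂ) (N : ℕ) (ξ η : ℝ) (ω : Ω) : ℝ :=
  charDet X N ξ η ω - ∫ ω', charDet X N ξ η ω' ∂P

/-! Write `H_k` for the probabilists' Hermite polynomials, `K_n` for their Christoffel–Darboux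
kernel and `γ` for the excess of `Q`. The theorem rests on an exact formula
(`integral_det_mul_det`): the mean of the product of the characteristic polynomials of size `n` at
`x` and `y` is `n! ∑ γ^m / m! K_{n+1-2m}(x, y)`. Thus `Q` enters only through `γ`.

The formula is proved by induction on the size. Expand both determinants along one row and its
column, and average over that row, which is independent of the remaining minor. By Jacobi's formula
the traces of adjugates that appear are derivatives of the correlation function of the minor. The
trace of a product of two adjugates reduces to such traces by the resolvent identity. The fourth
cumulant of the row entries adds `2 γ n` times the correlation function one further size down. The
closed formula satisfies the resulting recursion (`detCorr_succ`). The same expansion for one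
determinant gives the mean `(-1)^n H_n`, and subtracting the product of the means replaces `K_{N+1}`
by `K_N` in the term `m = 0` (`detCov_eq_tsum`).

For the limit, no pointwise asymptotics of `H_N` are needed. The pair `e^{-x²/4} H_N`, `√N e^{-x²/4}
H_{N-1}` solves a linear system whose coefficients are, at `x = √N ξ + t/√N`, constant up to
`O(1/N)`. A complex combination `Z` of the two therefore rotates, `Z(t)/Z(s) → e^{iω(t-s)}` with `ω
= √(4-ξ²)/2`, by Gronwall's inequality. The kernel off the diagonal is a multiple of `Im (Z(t) conj
Z(s)) / (ω(t-s))`, and on the diagonal of `|Z|²` up to `O(1/N)`, so the normalized `K_N` tends to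
`sinc (ω(t-s))`. Lowering the index of the kernel by a fixed amount is negligible in the bulk. By
dominated convergence the covariance is asymptotic to `e^γ` times the `γ = 0` expression, and `e^γ`
cancels in the correlation coefficient. -/

/-! ### Hermite polynomials and the Christoffel–Darboux kernel -/

/-- The probabilists' Hermite polynomials as real functions. -/
noncomputable def hermiteFun (n : ℕ) (x : ℝ) : ℝ := Polynomial.aeval x (Polynomial.hermite n)

theorem derivative_hermite (n : ℕ) : Polynomial.derivative (Polynomial.hermite (n + 1)) =
    ((n : Polynomial ℤ) + 1) * Polynomial.hermite n := by
  induction n with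
  | zero => simp
  | succ n ih =>
    rw [Polynomial.hermite_succ (n + 1), Polynomial.derivative_sub, Polynomial.derivative_mul,
      ih, Polynomial.derivative_mul, Polynomial.hermite_succ n]
    simp
    ring

theorem hermiteFun_zero (x : ℝ) : hermiteFun 0 x = 1 := by simp [hermiteFun]

/-- At `n = 0` the truncated index `n - 1` does no harm, because its coefficient is `0`. The
formulas below with index `n - 1` share this convention. -/
theorem hasDerivAt_hermiteFun (n : ℕ) (x : ℝ) :
    HasDerivAt (hermiteFun n) (n * hermiteFun (n - 1) x) x := by
  have h := Polynomial.hasDerivAt_aeval (Polynomial.hermite n) x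
  refine h.congr_deriv ?_
  cases n with
  | zero => simp
  | succ n => rw [derivative_hermite, map_mul]; simp [hermiteFun, -Polynomial.hermite_succ]

theorem hermiteFun_succ (n : ℕ) (x : ℝ) :
    hermiteFun (n + 1) x = x * hermiteFun n x - n * hermiteFun (n - 1) x := by
  cases n with
  | zero => simp [hermiteFun]
  | succ n =>
    rw [hermiteFun, Polynomial.hermite_succ (n + 1), derivative_hermite, map_sub, map_mul, map_mul]
    simp [hermiteFun, -Polynomial.hermite_succ]

/-- The Christoffel–Darboux kernel of the Hermite polynomials. -/
noncomputable def hermiteKernel (n : ℕ) (x y : ℝ) : ℝ :=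
  ∑ k ∈ Finset.range n, hermiteFun k x * hermiteFun k y / k.factorial

/-- The derivative of `hermiteKernel` in the first variable. -/
noncomputable def hermiteKernelFst (n : ℕ) (x y : ℝ) : ℝ :=
  ∑ k ∈ Finset.range n, (k * hermiteFun (k - 1) x) * hermiteFun k y / k.factorial

/-- The mixed derivative of `hermiteKernel`. -/
noncomputable def hermiteKernelMixed (n : ℕ) (x y : ℝ) : ℝ :=
  ∑ k ∈ Finset.range n,
    (k * hermiteFun (k - 1) x) * (k * hermiteFun (k - 1) y) / k.factorial

theorem hermiteKernel_comm (n : ℕ) (x y : ℝ) : hermiteKernel n x y = hermiteKernel n y x :=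
  Finset.sum_congr rfl fun _ _ => by rw [mul_comm (hermiteFun _ x)]

theorem hermiteKernel_zero (x y : ℝ) : hermiteKernel 0 x y = 0 := by simp [hermiteKernel]

theorem hermiteKernel_succ (n : ℕ) (x y : ℝ) : hermiteKernel (n + 1) x y =
    hermiteKernel n x y + hermiteFun n x * hermiteFun n y / n.factorial :=
  Finset.sum_range_succ _ _

theorem hermiteKernelFst_succ (n : ℕ) (x y : ℝ) : hermiteKernelFst (n + 1) x y =
    hermiteKernelFst n x y + (n * hermiteFun (n - 1) x) * hermiteFun n y / n.factorial :=
  Finset.sum_range_succ _ _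

theorem hermiteKernelMixed_succ (n : ℕ) (x y : ℝ) : hermiteKernelMixed (n + 1) x y =
    hermiteKernelMixed n x y +
      (n * hermiteFun (n - 1) x) * (n * hermiteFun (n - 1) y) / n.factorial :=
  Finset.sum_range_succ _ _

theorem hasDerivAt_hermiteKernel (n : ℕ) (x y : ℝ) :
    HasDerivAt (fun x => hermiteKernel n x y) (hermiteKernelFst n x y) x :=
  HasDerivAt.fun_sum fun k _ => ((hasDerivAt_hermiteFun k x).mul_const _).div_const _

theorem hasDerivAt_hermiteKernelFst (n : ℕ) (x y : ℝ) :
    HasDerivAt (fun y => hermiteKernelFst n x y) (hermiteKernelMixed n x y) y :=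
  HasDerivAt.fun_sum fun k _ => ((hasDerivAt_hermiteFun k y).const_mul _).div_const _

/-- The Christoffel–Darboux formula. -/
theorem sub_mul_hermiteKernel (n : ℕ) (x y : ℝ) : (x - y) * hermiteKernel n x y =
    n * (hermiteFun n x * hermiteFun (n - 1) y - hermiteFun (n - 1) x * hermiteFun n y) /
      n.factorial := by
  induction n with
  | zero => simp [hermiteKernel]
  | succ n ih =>
    rw [hermiteKernel_succ, mul_add, ih, hermiteFun_succ n x, hermiteFun_succ n y,
      Nat.factorial_succ]
    have := Nat.factorial_ne_zero n
    push_cast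
    field_simp
    ring

/-- The confluent Christoffel–Darboux formula, with the derivatives of `H_n` and `H_{n-1}`
eliminated by the lowering relation and the three-term recurrence. -/
theorem hermiteKernel_self (n : ℕ) (x : ℝ) : hermiteKernel n x x =
    (hermiteFun n x ^ 2 + n * hermiteFun (n - 1) x ^ 2
      - x * hermiteFun n x * hermiteFun (n - 1) x) * n / n.factorial := by
  induction n with
  | zero => simp [hermiteKernel]
  | succ n ih =>
    rw [hermiteKernel_succ, ih, hermiteFun_succ n x, Nat.factorial_succ]
    have := Nat.factorial_ne_zero n
    push_cast
    field_simp
    ring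

/-- The recursion of the correlation function in the case `γ = 0`, multiplied by `x - y` to stay
polynomial. When `n` grows by one, the new terms in the bracket combine to `H_n H_n + H_{n+1}
H_{n+1}` over `n!`, and the new term in the difference of first derivatives is `(x - y) K_n` by
Christoffel–Darboux. -/
theorem hermiteKernel_recursion (n : ℕ) (x y : ℝ) :
    (x - y) * ((1 + x * y) * hermiteKernel n x y - x * hermiteKernelFst n y x
      - y * hermiteKernelFst n x y + hermiteKernelMixed n x y)
      - (hermiteKernelFst n x y - hermiteKernelFst n y x) =
    (x - y) * (n * hermiteKernel (n + 1) x y) := by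
  induction n with
  | zero => simp [hermiteKernel, hermiteKernelFst, hermiteKernelMixed]
  | succ n ih =>
    have hcd := sub_mul_hermiteKernel n x y
    rw [hermiteKernel_succ (n + 1), hermiteFun_succ n x, hermiteFun_succ n y,
      Nat.factorial_succ]
    rw [hermiteKernel_succ] at ih ⊢
    rw [hermiteKernelFst_succ, hermiteKernelFst_succ, hermiteKernelMixed_succ]
    have hf : (n.factorial : ℝ) ≠ 0 := by exact_mod_cast Nat.factorial_ne_zero n
    have hn : (n : ℝ) + 1 ≠ 0 := by positivity
    push_cast
    have e : ∀ a b : ℝ, (n + 1 : ℝ) * (a * b / ((n + 1 : ℝ) * n.factorial)) =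
      a * b / n.factorial := fun a b => by field_simp
    rw [mul_add ((n : ℝ) + 1), e]
    linear_combination ih - hcd

/-! ### The closed formula for the correlation function and its recursion -/

/-- The second-order correlation function of the characteristic polynomial of an `n × n`
Hermitian Wigner matrix whose off-diagonal entries satisfy `𝔼 |X|⁴ = 2 + 2 γ`. -/
noncomputable def detCorr (γ : ℝ) (n : ℕ) (x y : ℝ) : ℝ :=
  n.factorial * ∑ m ∈ Finset.range (n + 1),
    γ ^ m / m.factorial * hermiteKernel (n + 1 - 2 * m) x y

/-- The derivative of `detCorr` in the first variable. -/
noncomputable def detCorrFst (γ : ℝ) (n : ℕ) (x y : ℝ) : ℝ :=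
  n.factorial * ∑ m ∈ Finset.range (n + 1),
    γ ^ m / m.factorial * hermiteKernelFst (n + 1 - 2 * m) x y

/-- The mixed derivative of `detCorr`. -/
noncomputable def detCorrMixed (γ : ℝ) (n : ℕ) (x y : ℝ) : ℝ :=
  n.factorial * ∑ m ∈ Finset.range (n + 1),
    γ ^ m / m.factorial * hermiteKernelMixed (n + 1 - 2 * m) x y

theorem hasDerivAt_detCorr (γ : ℝ) (n : ℕ) (x y : ℝ) :
    HasDerivAt (fun x => detCorr γ n x y) (detCorrFst γ n x y) x :=
  (HasDerivAt.fun_sum fun _ _ => (hasDerivAt_hermiteKernel _ x y).const_mul _).const_mul _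

theorem hasDerivAt_detCorrFst (γ : ℝ) (n : ℕ) (x y : ℝ) :
    HasDerivAt (fun y => detCorrFst γ n x y) (detCorrMixed γ n x y) y :=
  (HasDerivAt.fun_sum fun _ _ => (hasDerivAt_hermiteKernelFst _ x y).const_mul _).const_mul _

/-- Beyond `2 * m > n` the truncated index is `0` and the kernel vanishes, so the cutoff of the sum
is immaterial. -/
theorem detCorr_eq_sum (γ : ℝ) {n M : ℕ} (hM : n < 2 * M) (x y : ℝ) :
    detCorr γ n x y = n.factorial * ∑ m ∈ Finset.range M,
      γ ^ m / m.factorial * hermiteKernel (n + 1 - 2 * m) x y := by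
  have key : ∀ A B : ℕ, n < 2 * A → A ≤ B → ∑ m ∈ Finset.range A,
      γ ^ m / m.factorial * hermiteKernel (n + 1 - 2 * m) x y = ∑ m ∈ Finset.range B,
      γ ^ m / m.factorial * hermiteKernel (n + 1 - 2 * m) x y := fun A B hA hAB => by
    refine Finset.sum_subset (Finset.range_mono hAB) fun m _ hm => ?_
    rw [Finset.mem_range, not_lt] at hm
    rw [show n + 1 - 2 * m = 0 by omega, hermiteKernel_zero, mul_zero]
  rw [detCorr, key (n + 1) (max M (n + 1)) (by omega) (le_max_right _ _),
    key M (max M (n + 1)) hM (le_max_left _ _)]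

/-- This is the recursion that the Laplace expansion produces for the true correlation function.
Applied term by term, `hermiteKernel_recursion` yields the factor `n + 1 - 2m` where `n + 1` is
wanted. The missing `2m` is supplied by the `γ`-term after a shift of `m`, since `2m γ^m / m! = 2γ
γ^(m-1) / (m-1)!`. -/
theorem detCorr_succ (γ : ℝ) (n : ℕ) (x y : ℝ) :
    (x - y) * detCorr γ (n + 1) x y =
    (x - y) * ((1 + x * y) * detCorr γ n x y - x * detCorrFst γ n y x
      - y * detCorrFst γ n x y + detCorrMixed γ n x y + 2 * γ * n * detCorr γ (n - 1) x y)
      - (detCorrFst γ n x y - detCorrFst γ n y x) := by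
  have h1 : (x - y) * ((1 + x * y) * detCorr γ n x y - x * detCorrFst γ n y x
      - y * detCorrFst γ n x y + detCorrMixed γ n x y)
      - (detCorrFst γ n x y - detCorrFst γ n y x) = (x - y) * (n.factorial *
      ∑ m ∈ Finset.range (n + 1), γ ^ m / m.factorial *
        (((n + 1 - 2 * m : ℕ) : ℝ) * hermiteKernel (n + 1 - 2 * m + 1) x y)) := by
    have h2 : ∀ m, γ ^ m / m.factorial * ((x - y) * (((n + 1 - 2 * m : ℕ) : ℝ) *
        hermiteKernel (n + 1 - 2 * m + 1) x y)) = _ :=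
      fun m => congrArg (γ ^ m / m.factorial * ·)
        (hermiteKernel_recursion (n + 1 - 2 * m) x y).symm
    have h3 : (x - y) * (n.factorial * ∑ m ∈ Finset.range (n + 1), γ ^ m / m.factorial *
        (((n + 1 - 2 * m : ℕ) : ℝ) * hermiteKernel (n + 1 - 2 * m + 1) x y)) =
        n.factorial * ∑ m ∈ Finset.range (n + 1), γ ^ m / m.factorial * ((x - y) *
          (((n + 1 - 2 * m : ℕ) : ℝ) * hermiteKernel (n + 1 - 2 * m + 1) x y)) := by
      rw [mul_left_comm, Finset.mul_sum]
      simp only [mul_left_comm]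
    rw [h3, Finset.sum_congr rfl fun m _ => h2 m]
    simp only [detCorr, detCorrFst, detCorrMixed, Finset.mul_sum, ← Finset.sum_add_distrib,
      ← Finset.sum_sub_distrib]
    refine Finset.sum_congr rfl fun m _ => ?_
    ring
  have h4 : 2 * γ * n * detCorr γ (n - 1) x y = n.factorial * ∑ m ∈ Finset.range (n + 1),
      γ ^ m / m.factorial * (2 * m * hermiteKernel (n + 2 - 2 * m) x y) := by
    rw [Finset.sum_range_succ']
    rcases n with _ | n
    · simp
    · rw [detCorr_eq_sum γ (show n + 1 - 1 < 2 * (n + 1) by omega), Nat.factorial_succ]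
      simp only [Finset.mul_sum, Nat.add_sub_cancel, Nat.cast_zero, mul_zero, zero_mul, add_zero]
      refine Finset.sum_congr rfl fun m _ => ?_
      rw [show n + 1 + 2 - 2 * (m + 1) = n + 1 - 2 * m by omega, Nat.factorial_succ]
      have := Nat.factorial_ne_zero m
      push_cast
      field_simp
      ring
  have h5 : detCorr γ (n + 1) x y = n.factorial * ∑ m ∈ Finset.range (n + 1),
        γ ^ m / m.factorial * ((n + 1 : ℝ) * hermiteKernel (n + 2 - 2 * m) x y) := by
    rw [detCorr_eq_sum γ (show n + 1 < 2 * (n + 1) by omega), Nat.factorial_succ]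
    simp only [Finset.mul_sum]
    refine Finset.sum_congr rfl fun m _ => ?_
    push_cast
    ring
  have h6 : detCorr γ (n + 1) x y - 2 * γ * n * detCorr γ (n - 1) x y = n.factorial *
      ∑ m ∈ Finset.range (n + 1), γ ^ m / m.factorial *
        (((n + 1 - 2 * m : ℕ) : ℝ) * hermiteKernel (n + 1 - 2 * m + 1) x y) := by
    rw [h5, h4, ← mul_sub, ← Finset.sum_sub_distrib]
    congr 1
    refine Finset.sum_congr rfl fun m _ => ?_
    -- Truncated and true subtraction agree in the first case; in the second both sides are zero.
    rcases le_or_gt (2 * m) (n + 1) with hm | hm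
    · rw [Nat.cast_sub hm, show n + 2 - 2 * m = n + 1 - 2 * m + 1 by omega]
      push_cast
      ring
    · rw [show n + 2 - 2 * m = 0 by omega, show n + 1 - 2 * m = 0 by omega]
      simp [hermiteKernel_zero]
  linear_combination (x - y) * h6 - h1

/-! ### Determinant and adjugate identities -/

namespace Matrix

/-- Laplace expansion of a determinant along its first row and its first column. -/
theorem det_succ_eq_sub_sum_adjugate {R : Type*} [CommRing R] {n : ℕ}
    (M : Matrix (Fin (n + 1)) (Fin (n + 1)) R) :
    M.det = M 0 0 * (M.submatrix Fin.succ Fin.succ).det -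
      ∑ i, ∑ j, M 0 i.succ * (M.submatrix Fin.succ Fin.succ).adjugate i j * M j.succ 0 := by
  rw [det_succ_row_zero, Fin.sum_univ_succ, sub_eq_add_neg, ← Finset.sum_neg_distrib]
  congr 1
  · simp
  · refine Finset.sum_congr rfl fun i _ => ?_
    rcases n with _ | n
    · exact i.elim0
    · rw [det_succ_column_zero, Finset.mul_sum, ← Finset.sum_neg_distrib]
      refine Finset.sum_congr rfl fun j _ => ?_
      rw [adjugate_fin_succ_eq_det_submatrix]
      have h1 : ((M.submatrix Fin.succ i.succ.succAbove).submatrix j.succAbove Fin.succ) =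
          (M.submatrix Fin.succ Fin.succ).submatrix j.succAbove i.succAbove := by
        ext a b
        simp
      rw [h1]
      simp only [submatrix_apply, Fin.succ_succAbove_zero, Fin.val_succ]
      ring

/-- The resolvent identity with denominators cleared, hence valid for singular matrices too. It is
the source of the factor `x - y` in the recursions. -/
theorem sub_mul_trace_adjugate_mul_adjugate {R : Type*} [CommRing R] {n : Type*} [Fintype n]
    [DecidableEq n] (A : Matrix n n R) (x y : R) :
    (x - y) * ((A - x • 1).adjugate * (A - y • 1).adjugate).trace =
      (A - x • 1).adjugate.trace * (A - y • 1).det -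
        (A - x • 1).det * (A - y • 1).adjugate.trace := by
  have h1 : (A - x • 1).adjugate * ((A - y • 1) - (A - x • 1)) * (A - y • 1).adjugate =
      (A - y • 1).det • (A - x • 1).adjugate - (A - x • 1).det • (A - y • 1).adjugate := by
    rw [mul_sub, sub_mul, mul_assoc, mul_adjugate, adjugate_mul]
    simp
  have h2 : (A - y • 1) - (A - x • 1) = (x - y) • (1 : Matrix n n R) := by
    rw [sub_smul]
    abel
  rw [h2] at h1
  have h3 := congrArg trace h1
  rw [Matrix.mul_smul, mul_one, smul_mul_assoc, trace_smul, trace_sub, trace_smul, trace_smul] at h3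
  simp only [smul_eq_mul] at h3
  rw [h3]
  ring

/-- Jacobi's formula. In the Leibniz expansion, the terms whose factor from column `i` is
differentiated add up to minus the determinant with column `i` replaced by a unit vector, that is,
minus a diagonal cofactor. -/
theorem hasDerivAt_det_sub_smul_one {n : Type*} [Fintype n] [DecidableEq n]
    (A : Matrix n n ℂ) (x : ℝ) :
    HasDerivAt (fun x : ℝ => (A - (x : ℂ) • (1 : Matrix n n ℂ)).det)
      (-(A - (x : ℂ) • (1 : Matrix n n ℂ)).adjugate.trace) x := by
  have hent : ∀ i j, HasDerivAt (fun x : ℝ => (A - (x : ℂ) • (1 : Matrix n n ℂ)) i j)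
      (-(1 : Matrix n n ℂ) i j) x := fun i j => by
    simpa using ((Complex.ofRealCLM.hasDerivAt (x := x)).mul_const
      ((1 : Matrix n n ℂ) i j)).const_sub (A i j)
  simp only [det_apply']
  refine (HasDerivAt.fun_sum fun σ _ => (HasDerivAt.fun_finsetProd
    fun i _ => hent (σ i) i).const_mul _).congr_deriv ?_
  have hadj : ∀ (B : Matrix n n ℂ) i, B.adjugate i i = (B.updateCol i (Pi.single i 1)).det :=
    fun B i => by rw [← cramer_apply, cramer_eq_adjugate_mulVec, mulVec_single_one, col_apply]
  simp only [trace, diag_apply, hadj, det_apply', smul_eq_mul, Finset.mul_sum]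
  rw [Finset.sum_comm, ← Finset.sum_neg_distrib]
  refine Finset.sum_congr rfl fun i _ => ?_
  rw [← Finset.sum_neg_distrib]
  refine Finset.sum_congr rfl fun σ _ => ?_
  rw [← Finset.mul_prod_erase _ _ (Finset.mem_univ i), updateCol_self,
    Finset.prod_congr rfl fun j hj => updateCol_ne (Finset.ne_of_mem_erase hj)]
  simp only [one_apply, Pi.single_apply]
  ring

end Matrix

/-! ### Independence of entries at different positions -/

/-- The matrix position, up to transposition, that a component contributes to. -/
def componentEdge : ℕ ⊕ (UpperPair ⊕ UpperPair) → Sym2 ℕ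
  | Sum.inl i => s(i, i)
  | Sum.inr (Sum.inl p) => s(p.1.1, p.1.2)
  | Sum.inr (Sum.inr p) => s(p.1.1, p.1.2)

/-- The σ-algebra generated by the matrix entries at the positions in `E`. -/
@[reducible]
noncomputable def edgeAlgebra {Ω : Type*} (X : ℕ → ℕ → Ω → ℂ) (E : Set (Sym2 ℕ)) :
    MeasurableSpace Ω :=
  ⨆ k ∈ componentEdge ⁻¹' E, MeasurableSpace.comap (wignerComponent X k) inferInstance

theorem edgeAlgebra_mono {Ω : Type*} (X : ℕ → ℕ → Ω → ℂ) {E F : Set (Sym2 ℕ)} (h : E ⊆ F) :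
    edgeAlgebra X E ≤ edgeAlgebra X F :=
  biSup_mono fun _ hk => h hk

theorem measurable_wignerComponent_edgeAlgebra {Ω : Type*} (X : ℕ → ℕ → Ω → ℂ)
    {E : Set (Sym2 ℕ)} {k : ℕ ⊕ (UpperPair ⊕ UpperPair)} (hk : componentEdge k ∈ E) :
    Measurable[edgeAlgebra X E] (wignerComponent X k) := by
  rw [measurable_iff_comap_le]
  exact le_biSup (fun k => MeasurableSpace.comap (wignerComponent X k) inferInstance) hk

theorem apply_eq_component {Ω : Type*} (X : ℕ → ℕ → Ω → ℂ) (p : UpperPair) (ω : Ω) :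
    X p.1.1 p.1.2 ω = (wignerComponent X (Sum.inr (Sum.inl p)) ω : ℂ) +
      (wignerComponent X (Sum.inr (Sum.inr p)) ω : ℂ) * Complex.I := by
  simp [wignerComponent, Complex.re_add_im]

theorem measurable_prod_edgeAlgebra {Ω : Type*} {X : ℕ → ℕ → Ω → ℂ} {ι : Type*}
    {s : Finset ι} {E : ι → Sym2 ℕ} {φ : ι → Ω → ℂ}
    (hφ : ∀ i ∈ s, Measurable[edgeAlgebra X {E i}] (φ i)) :
    Measurable[edgeAlgebra X (E '' s)] (fun ω => ∏ i ∈ s, φ i ω) :=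
  Finset.measurable_fun_prod s fun i hi => (hφ i hi).mono
    (edgeAlgebra_mono X (Set.singleton_subset_iff.2 ⟨i, hi, rfl⟩)) le_rfl

namespace IsWignerArray

variable {Ω : Type*} [mΩ : MeasurableSpace Ω] {P : Measure Ω} {Q : Measure ℝ}
  {X : ℕ → ℕ → Ω → ℂ}

theorem edgeAlgebra_le (hX : IsWignerArray Q P X) (E : Set (Sym2 ℕ)) : edgeAlgebra X E ≤ mΩ :=
  iSup₂_le fun k _ => (hX.measurable k).comap_le

/-- Each real component belongs to exactly one unordered position, so disjoint sets of positions
involve disjoint families of components. Working with unordered positions keeps an entry and its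
conjugate together. -/
theorem indep_edgeAlgebra (hX : IsWignerArray Q P X) {E F : Set (Sym2 ℕ)} (h : Disjoint E F) :
    Indep (edgeAlgebra X E) (edgeAlgebra X F) P :=
  indep_iSup_of_disjoint (fun k => (hX.measurable k).comap_le) hX.indep (h.preimage _)

theorem apply_self (hX : IsWignerArray Q P X) (i : ℕ) (ω : Ω) :
    X i i ω = ((√2 * wignerComponent X (Sum.inl i) ω : ℝ) : ℂ) := by
  have h := hX.hermitian i i ω
  rw [wignerComponent, mul_div_cancel₀ _ (by positivity)]
  exact (Complex.conj_eq_iff_re.mp h.symm).symm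

theorem measurable_edgeAlgebra (hX : IsWignerArray Q P X) {i j : ℕ} {E : Set (Sym2 ℕ)}
    (hE : s(i, j) ∈ E) : Measurable[edgeAlgebra X E] (X i j) := by
  have key : ∀ p : UpperPair, s(p.1.1, p.1.2) ∈ E →
      Measurable[edgeAlgebra X E] (X p.1.1 p.1.2) := fun p hp => by
    have h1 := measurable_wignerComponent_edgeAlgebra X (k := Sum.inr (Sum.inl p)) hp
    have h2 := measurable_wignerComponent_edgeAlgebra X (k := Sum.inr (Sum.inr p)) hp
    rw [show X p.1.1 p.1.2 = _ from funext fun ω => apply_eq_component X p ω]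
    exact (Complex.measurable_ofReal.comp h1).add
      ((Complex.measurable_ofReal.comp h2).mul_const Complex.I)
  rcases lt_trichotomy i j with h | rfl | h
  · exact key ⟨(i, j), h⟩ hE
  · rw [show X i i = _ from funext fun ω => hX.apply_self i ω]
    exact Complex.measurable_ofReal.comp
      ((measurable_wignerComponent_edgeAlgebra X (k := Sum.inl i) hE).const_mul _)
  · rw [show X i j = _ from funext fun ω => hX.hermitian j i ω]
    exact continuous_star.measurable.comp (key ⟨(j, i), h⟩ (by rwa [Sym2.eq_swap] at hE))

theorem measurable_entry (hX : IsWignerArray Q P X) (i j : ℕ) : Measurable (X i j) :=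
  (hX.measurable_edgeAlgebra (Set.mem_univ s(i, j))).mono (hX.edgeAlgebra_le _) le_rfl

theorem indepFun_of_disjoint (hX : IsWignerArray Q P X) {E F : Set (Sym2 ℕ)} (h : Disjoint E F)
    {f g : Ω → ℂ} (hf : Measurable[edgeAlgebra X E] f) (hg : Measurable[edgeAlgebra X F] g) :
    IndepFun f g P :=
  indep_of_indep_of_le_left (indep_of_indep_of_le_right (hX.indep_edgeAlgebra h) hg.comap_le)
    hf.comap_le

/-- The product formula for independent variables needs no integrability; that is only required
later, to split integrals of sums. -/
theorem integral_mul_of_disjoint (hX : IsWignerArray Q P X) {E F : Set (Sym2 ℕ)}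
    (h : Disjoint E F) {f g : Ω → ℂ} (hf : Measurable[edgeAlgebra X E] f)
    (hg : Measurable[edgeAlgebra X F] g) :
    ∫ ω, f ω * g ω ∂P = (∫ ω, f ω ∂P) * ∫ ω, g ω ∂P :=
  (hX.indepFun_of_disjoint h hf hg).integral_fun_mul_eq_mul_integral
    (hf.mono (hX.edgeAlgebra_le _) le_rfl).aestronglyMeasurable
    (hg.mono (hX.edgeAlgebra_le _) le_rfl).aestronglyMeasurable

theorem integrable_mul_of_disjoint (hX : IsWignerArray Q P X) {E F : Set (Sym2 ℕ)}
    (h : Disjoint E F) {f g : Ω → ℂ} (hf : Measurable[edgeAlgebra X E] f)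
    (hg : Measurable[edgeAlgebra X F] g) (hfi : Integrable f P) (hgi : Integrable g P) :
    Integrable (fun ω => f ω * g ω) P :=
  (hX.indepFun_of_disjoint h hf hg).integrable_mul hfi hgi

theorem integral_prod (hX : IsWignerArray Q P X) [IsProbabilityMeasure P] {ι : Type*}
    (s : Finset ι) {E : ι → Sym2 ℕ} (hE : Function.Injective E) {φ : ι → Ω → ℂ}
    (hφ : ∀ i ∈ s, Measurable[edgeAlgebra X {E i}] (φ i)) :
    ∫ ω, ∏ i ∈ s, φ i ω ∂P = ∏ i ∈ s, ∫ ω, φ i ω ∂P := by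
  classical
  induction s using Finset.induction_on with
  | empty => simp
  | insert a s ha ih =>
    rw [Finset.prod_insert ha, ← ih fun i hi => hφ i (Finset.mem_insert_of_mem hi)]
    simp only [Finset.prod_insert ha]
    refine hX.integral_mul_of_disjoint ?_ (hφ a (Finset.mem_insert_self _ _))
      (measurable_prod_edgeAlgebra fun i hi => hφ i (Finset.mem_insert_of_mem hi))
    rw [Set.disjoint_singleton_left]
    rintro ⟨b, hb, hab⟩
    exact ha (hE hab ▸ hb)

theorem integrable_prod (hX : IsWignerArray Q P X) [IsProbabilityMeasure P] {ι : Type*}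
    (s : Finset ι) {E : ι → Sym2 ℕ} (hE : Function.Injective E) {φ : ι → Ω → ℂ}
    (hφ : ∀ i ∈ s, Measurable[edgeAlgebra X {E i}] (φ i))
    (hi : ∀ i ∈ s, Integrable (φ i) P) :
    Integrable (fun ω => ∏ i ∈ s, φ i ω) P := by
  classical
  induction s using Finset.induction_on with
  | empty => simp
  | insert a s ha ih =>
    simp only [Finset.prod_insert ha]
    refine hX.integrable_mul_of_disjoint ?_ (hφ a (Finset.mem_insert_self _ _))
      (measurable_prod_edgeAlgebra fun i hi => hφ i (Finset.mem_insert_of_mem hi))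
      (hi a (Finset.mem_insert_self _ _))
      (ih (fun i hi => hφ i (Finset.mem_insert_of_mem hi))
        fun i h => hi i (Finset.mem_insert_of_mem h))
    rw [Set.disjoint_singleton_left]
    rintro ⟨b, hb, hab⟩
    exact ha (hE hab ▸ hb)

/-! ### Moments of the entries -/

theorem integral_component (hX : IsWignerArray Q P X) (k : ℕ ⊕ (UpperPair ⊕ UpperPair)) (n : ℕ) :
    ∫ ω, wignerComponent X k ω ^ n ∂P = ∫ x, x ^ n ∂Q := by
  rw [← hX.law k, integral_map (hX.measurable k).aemeasurable
    (continuous_pow n).aestronglyMeasurable]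

theorem memLp_component (hX : IsWignerArray Q P X) (hQ : WignerMoments Q)
    (k : ℕ ⊕ (UpperPair ⊕ UpperPair)) : MemLp (wignerComponent X k) 4 P := by
  have h : Integrable (fun ω => wignerComponent X k ω ^ 4) P := by
    have h0 := hQ.integrable_pow_four
    rw [← hX.law k] at h0
    exact h0.comp_measurable (hX.measurable k)
  refine (integrable_norm_rpow_iff (p := 4) (hX.measurable k).aestronglyMeasurable
    (by norm_num) (by norm_num)).1 (h.congr (ae_of_all _ fun ω => ?_))
  simp only [ENNReal.toReal_ofNat, Real.norm_eq_abs]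
  norm_cast
  rw [Even.pow_abs ⟨2, rfl⟩]

theorem memLp_entry (hX : IsWignerArray Q P X) (hQ : WignerMoments Q) (i j : ℕ) :
    MemLp (X i j) 4 P := by
  have key : ∀ p : UpperPair, MemLp (X p.1.1 p.1.2) 4 P := fun p => by
    have h1 : MemLp (fun ω => (wignerComponent X (Sum.inr (Sum.inl p)) ω : ℂ)) 4 P :=
      (hX.memLp_component hQ (Sum.inr (Sum.inl p))).ofReal
    have h2 : MemLp (fun ω => (wignerComponent X (Sum.inr (Sum.inr p)) ω : ℂ)) 4 P :=
      (hX.memLp_component hQ (Sum.inr (Sum.inr p))).ofReal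
    have h3 := h1.add (h2.mul_const Complex.I)
    exact h3.congr_norm (hX.measurable_entry _ _).aestronglyMeasurable
      (ae_of_all _ fun ω => by rw [apply_eq_component X p ω]; rfl)
  rcases lt_trichotomy i j with h | h | h
  · exact key ⟨(i, j), h⟩
  · subst h
    have h1 : MemLp (fun ω => ((√2 * wignerComponent X (Sum.inl i) ω : ℝ) : ℂ)) 4 P :=
      ((hX.memLp_component hQ (Sum.inl i)).const_mul _).ofReal
    exact h1.congr_norm (hX.measurable_entry _ _).aestronglyMeasurable
      (ae_of_all _ fun ω => by rw [hX.apply_self i ω])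
  · exact (key ⟨(j, i), h⟩).congr_norm (hX.measurable_entry _ _).aestronglyMeasurable
      (ae_of_all _ fun ω => by rw [hX.hermitian j i ω, norm_star])

theorem integrable_norm_entry_pow_four (hX : IsWignerArray Q P X) (hQ : WignerMoments Q)
    (i j : ℕ) : Integrable (fun ω => ‖X i j ω‖ ^ 4) P := by
  have := (hX.memLp_entry hQ i j).integrable_norm_rpow (by norm_num) (by norm_num)
  simp only [ENNReal.toReal_ofNat] at this
  exact_mod_cast this

theorem integral_mul_component (hX : IsWignerArray Q P X) {k l : ℕ ⊕ (UpperPair ⊕ UpperPair)}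
    (hkl : k ≠ l) (m n : ℕ) :
    ∫ ω, wignerComponent X k ω ^ m * wignerComponent X l ω ^ n ∂P =
      (∫ x, x ^ m ∂Q) * ∫ x, x ^ n ∂Q := by
  rw [← hX.integral_component k, ← hX.integral_component l]
  exact ((hX.indep.indepFun hkl).comp (measurable_id.pow_const m)
    (measurable_id.pow_const n)).integral_fun_mul_eq_mul_integral
    ((hX.measurable k).pow_const m).aestronglyMeasurable
    ((hX.measurable l).pow_const n).aestronglyMeasurable

end IsWignerArray

/-- The excess parameter `∫ x⁴ Q(dx) - 3/4` of the entry distribution. -/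
noncomputable def excess (Q : Measure ℝ) : ℝ := ∫ x, x ^ 4 ∂Q - 3 / 4

namespace IsWignerArray

variable {Ω : Type*} [mΩ : MeasurableSpace Ω] {P : Measure Ω} [IsProbabilityMeasure P]
  {Q : Measure ℝ} {X : ℕ → ℕ → Ω → ℂ}

/-- A monomial of degree at most `4` is bounded by `M ^ 4` with `M = max 1 (max u v)`, and this is
one of `1`, `u ^ 4`, `v ^ 4`. -/
theorem integrable_component_mul (hX : IsWignerArray Q P X) (hQ : WignerMoments Q)
    (k l : ℕ ⊕ (UpperPair ⊕ UpperPair)) {m n : ℕ} (hmn : m + n ≤ 4) :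
    Integrable (fun ω => wignerComponent X k ω ^ m * wignerComponent X l ω ^ n) P := by
  have h4 : ∀ k, Integrable (fun ω => |wignerComponent X k ω| ^ 4) P := fun k => by
    have := (hX.memLp_component hQ k).integrable_norm_rpow (by norm_num) (by norm_num)
    simp only [ENNReal.toReal_ofNat, Real.norm_eq_abs] at this
    exact_mod_cast this
  refine (((integrable_const (1 : ℝ)).add (h4 k)).add (h4 l)).mono'
    (((hX.measurable k).pow_const m).mul ((hX.measurable l).pow_const n)).aestronglyMeasurable
    (ae_of_all _ fun ω => ?_)
  simp only [Real.norm_eq_abs, abs_mul, abs_pow, Pi.add_apply]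
  generalize hu : |wignerComponent X k ω| = u
  generalize hv : |wignerComponent X l ω| = v
  have hu0 : 0 ≤ u := hu ▸ abs_nonneg _
  have hv0 : 0 ≤ v := hv ▸ abs_nonneg _
  set M := max 1 (max u v) with hM
  have hM1 : 1 ≤ M := le_max_left _ _
  have huM : u ≤ M := (le_max_left _ _).trans (le_max_right _ _)
  have hvM : v ≤ M := (le_max_right _ _).trans (le_max_right _ _)
  calc u ^ m * v ^ n ≤ M ^ m * M ^ n := by gcongr
    _ = M ^ (m + n) := (pow_add _ _ _).symm
    _ ≤ M ^ 4 := pow_le_pow_right₀ hM1 hmn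
    _ ≤ 1 + u ^ 4 + v ^ 4 := by
      have := pow_nonneg hu0 4
      have := pow_nonneg hv0 4
      rcases max_choice (1 : ℝ) (max u v) with h | h
      · rw [hM, h]; linarith
      · rw [hM, h]
        rcases max_choice u v with h | h <;> rw [h] <;> linarith

theorem integral_entry (hX : IsWignerArray Q P X) (hQ : WignerMoments Q) (i j : ℕ) :
    ∫ ω, X i j ω ∂P = 0 := by
  have h0 : ∀ k, ∫ ω, wignerComponent X k ω ∂P = 0 := fun k => by
    simpa [hQ.mean] using hX.integral_component k 1
  have hi : ∀ k, Integrable (fun ω => (wignerComponent X k ω : ℂ)) P := fun k => by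
    simpa using (hX.integrable_component_mul hQ k k (m := 1) (n := 0) (by norm_num)).ofReal (𝕜 := ℂ)
  have key : ∀ p : UpperPair, ∫ ω, X p.1.1 p.1.2 ω ∂P = 0 := fun p => by
    simp only [apply_eq_component X p]
    rw [integral_add (hi _) ((hi _).mul_const _), integral_mul_const, integral_complex_ofReal,
      integral_complex_ofReal, h0, h0]
    simp
  rcases lt_trichotomy i j with h | rfl | h
  · exact key ⟨(i, j), h⟩
  · simp only [hX.apply_self, integral_complex_ofReal, integral_const_mul, h0]
    simp
  · simp only [hX.hermitian j i, Complex.star_def, integral_conj]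
    rw [key ⟨(j, i), h⟩, map_zero]

theorem integral_entry_mul_swap (hX : IsWignerArray Q P X) (hQ : WignerMoments Q) (i j : ℕ) :
    ∫ ω, X i j ω * X j i ω ∂P = 1 := by
  have h2 : ∀ k, ∫ ω, wignerComponent X k ω ^ 2 ∂P = 1 / 2 := fun k => by
    rw [hX.integral_component k 2, hQ.second_moment]
  have hi : ∀ k, Integrable (fun ω => wignerComponent X k ω ^ 2) P := fun k => by
    simpa using hX.integrable_component_mul hQ k k (m := 2) (n := 0) (by norm_num)
  have key : ∀ p : UpperPair, ∫ ω, X p.1.1 p.1.2 ω * X p.1.2 p.1.1 ω ∂P = 1 := fun p => by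
    have : ∀ ω, X p.1.1 p.1.2 ω * X p.1.2 p.1.1 ω =
        ((wignerComponent X (Sum.inr (Sum.inl p)) ω ^ 2 +
          wignerComponent X (Sum.inr (Sum.inr p)) ω ^ 2 : ℝ) : ℂ) := fun ω => by
      rw [hX.hermitian p.1.1 p.1.2, Complex.star_def, Complex.mul_conj, Complex.normSq_apply]
      simp only [wignerComponent]
      norm_cast
      ring
    simp only [this, integral_complex_ofReal]
    rw [integral_add (hi _) (hi _), h2, h2]
    norm_num
  rcases lt_trichotomy i j with h | rfl | h
  · exact key ⟨(i, j), h⟩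
  · have : ∀ ω, X i i ω * X i i ω = ((2 * wignerComponent X (Sum.inl i) ω ^ 2 : ℝ) : ℂ) :=
      fun ω => by
        rw [hX.apply_self, ← Complex.ofReal_mul]
        congr 1
        rw [mul_mul_mul_comm, Real.mul_self_sqrt (by norm_num), sq]
    simp only [this, integral_complex_ofReal, integral_const_mul, h2]
    norm_num
  · simp only [mul_comm (X i j _)]
    exact key ⟨(j, i), h⟩

/-- Real and imaginary parts are uncorrelated with equal variances. This removes one of the three
pairings in the fourth-order moments of a row. -/
theorem integral_entry_sq (hX : IsWignerArray Q P X) (hQ : WignerMoments Q) {i j : ℕ}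
    (hij : i ≠ j) : ∫ ω, X i j ω ^ 2 ∂P = 0 := by
  have h2 : ∀ k, ∫ ω, wignerComponent X k ω ^ 2 ∂P = 1 / 2 := fun k => by
    rw [hX.integral_component k 2, hQ.second_moment]
  have hi : ∀ k, Integrable (fun ω => wignerComponent X k ω ^ 2) P := fun k => by
    simpa using hX.integrable_component_mul hQ k k (m := 2) (n := 0) (by norm_num)
  have key : ∀ p : UpperPair, ∫ ω, X p.1.1 p.1.2 ω ^ 2 ∂P = 0 := fun p => by
    have : ∀ ω, X p.1.1 p.1.2 ω ^ 2 =
        ((wignerComponent X (Sum.inr (Sum.inl p)) ω ^ 2 -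
          wignerComponent X (Sum.inr (Sum.inr p)) ω ^ 2 : ℝ) : ℂ) +
        ((wignerComponent X (Sum.inr (Sum.inl p)) ω ^ 1 *
          wignerComponent X (Sum.inr (Sum.inr p)) ω ^ 1 : ℝ) : ℂ) * (2 * Complex.I) := fun ω => by
      rw [apply_eq_component X p]
      push_cast
      linear_combination (wignerComponent X (Sum.inr (Sum.inr p)) ω : ℂ) ^ 2 * Complex.I_sq
    simp only [this]
    rw [integral_add ((hi _).sub (hi _)).ofReal (((hX.integrable_component_mul hQ _ _
      (by norm_num)).ofReal).mul_const _), integral_mul_const, integral_complex_ofReal,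
      integral_complex_ofReal, integral_sub (hi _) (hi _), h2, h2,
      hX.integral_mul_component (by simp)]
    simp [hQ.mean]
  rcases hij.lt_or_gt with h | h
  · exact key ⟨(i, j), h⟩
  · simp only [hX.hermitian j i, Complex.star_def, ← map_pow, integral_conj]
    rw [key ⟨(j, i), h⟩, map_zero]

/-- The value is `2 ∫ x⁴ dQ + 2 (1/2)²`. Subtracting `3/4`, the fourth moment of a centered Gaussian
of variance `1/2`, makes the excess vanish in the Gaussian case. -/
theorem integral_entry_mul_swap_sq (hX : IsWignerArray Q P X) (hQ : WignerMoments Q) {i j : ℕ}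
    (hij : i ≠ j) : ∫ ω, (X i j ω * X j i ω) ^ 2 ∂P = 2 + 2 * excess Q := by
  have h4 : ∀ k, ∫ ω, wignerComponent X k ω ^ 4 ∂P = ∫ x, x ^ 4 ∂Q := fun k =>
    hX.integral_component k 4
  have hi : ∀ k, Integrable (fun ω => wignerComponent X k ω ^ 4) P := fun k => by
    simpa using hX.integrable_component_mul hQ k k (m := 4) (n := 0) (by norm_num)
  have key : ∀ p : UpperPair, ∫ ω, (X p.1.1 p.1.2 ω * X p.1.2 p.1.1 ω) ^ 2 ∂P =
      2 + 2 * excess Q := fun p => by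
    have : ∀ ω, (X p.1.1 p.1.2 ω * X p.1.2 p.1.1 ω) ^ 2 =
        ((wignerComponent X (Sum.inr (Sum.inl p)) ω ^ 4 +
          wignerComponent X (Sum.inr (Sum.inr p)) ω ^ 4 +
          2 * (wignerComponent X (Sum.inr (Sum.inl p)) ω ^ 2 *
          wignerComponent X (Sum.inr (Sum.inr p)) ω ^ 2) : ℝ) : ℂ) := fun ω => by
      rw [hX.hermitian p.1.1 p.1.2, Complex.star_def, Complex.mul_conj, Complex.normSq_apply]
      simp only [wignerComponent]
      norm_cast
      ring
    simp only [this, integral_complex_ofReal]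
    rw [integral_add (f := fun ω => wignerComponent X (Sum.inr (Sum.inl p)) ω ^ 4 +
      wignerComponent X (Sum.inr (Sum.inr p)) ω ^ 4) ((hi _).add (hi _))
      ((hX.integrable_component_mul hQ _ _
      (by norm_num)).const_mul _), integral_add (hi _) (hi _), integral_const_mul, h4, h4,
      hX.integral_mul_component (by simp), hQ.second_moment, excess]
    push_cast
    ring
  rcases hij.lt_or_gt with h | h
  · exact key ⟨(i, j), h⟩
  · simp only [mul_comm (X i j _)]
    exact key ⟨(j, i), h⟩

theorem integral_row_mul_row (hX : IsWignerArray Q P X) (hQ : WignerMoments Q) {n : ℕ}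
    {e : Fin n → ℕ} (he : Function.Injective e) {r : ℕ} (hr : ∀ i, e i ≠ r) (i j : Fin n) :
    ∫ ω, X r (e i) ω * X (e j) r ω ∂P = if i = j then 1 else 0 := by
  split_ifs with hij
  · subst hij
    exact hX.integral_entry_mul_swap hQ _ _
  · rw [hX.integral_mul_of_disjoint (E := {s(r, e i)}) (F := {s(e j, r)}) ?_
      (hX.measurable_edgeAlgebra rfl) (hX.measurable_edgeAlgebra rfl), hX.integral_entry hQ,
      zero_mul]
    rw [Set.disjoint_singleton, Ne, Sym2.eq_swap, Sym2.eq_iff]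
    rintro (⟨h, -⟩ | ⟨h, h'⟩)
    · exact hij (he h)
    · exact hr i h

/-- Exponents such as `(2, 1)` are excluded because third moments need not vanish; whenever they
occur in `integral_row_four`, another column has an exponent pair covered here. -/
theorem integral_row_pow (hX : IsWignerArray Q P X) (hQ : WignerMoments Q) {a r : ℕ}
    (ha : a ≠ r) {p q : ℕ} (hp : p ≤ 2) (hq : q ≤ 2) (hpq : p ≠ q) (h1 : p = 0 ∨ q = 0) :
    ∫ ω, X r a ω ^ p * X a r ω ^ q ∂P = 0 := by
  interval_cases p <;> interval_cases q <;> simp_all [hX.integral_entry hQ,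
    hX.integral_entry_sq hQ ha, hX.integral_entry_sq hQ ha.symm]

theorem integral_row_prod (hX : IsWignerArray Q P X) {n : ℕ}
    {e : Fin n → ℕ} (he : Function.Injective e) {r : ℕ} (hr : ∀ i, e i ≠ r) (p q : Fin n → ℕ) :
    ∫ ω, ∏ a, (X r (e a) ω ^ p a * X (e a) r ω ^ q a) ∂P =
      ∏ a, ∫ ω, X r (e a) ω ^ p a * X (e a) r ω ^ q a ∂P := by
  have hinj : Function.Injective fun a => s(r, e a) := fun a b hab => by
    rcases Sym2.eq_iff.1 hab with ⟨-, h⟩ | ⟨h, -⟩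
    · exact he h
    · exact absurd h.symm (hr b)
  refine hX.integral_prod Finset.univ hinj fun a _ => ?_
  have h1 : Measurable[edgeAlgebra X {s(r, e a)}] (X r (e a)) :=
    hX.measurable_edgeAlgebra (Set.mem_singleton _)
  have h2 : Measurable[edgeAlgebra X {s(r, e a)}] (X (e a) r) :=
    hX.measurable_edgeAlgebra (by rw [Sym2.eq_swap]; exact Set.mem_singleton _)
  exact (h1.pow_const _).mul (h2.pow_const _)

/-- Wick's rule with a fourth-cumulant correction. Factors are grouped by column; `p` and `q` count
those taken from the row and from the conjugate column. The mean survives only if the counts agree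
everywhere. When all four indices coincide, the two pairings account for the `2` in `2 + 2γ`. -/
theorem integral_row_four (hX : IsWignerArray Q P X) (hQ : WignerMoments Q) {n : ℕ}
    {e : Fin n → ℕ} (he : Function.Injective e) {r : ℕ} (hr : ∀ i, e i ≠ r)
    (i j k l : Fin n) :
    ∫ ω, X r (e i) ω * X (e j) r ω * (X r (e k) ω * X (e l) r ω) ∂P =
      (if i = j ∧ k = l then 1 else 0) + (if i = l ∧ j = k then 1 else 0) +
        (if i = j ∧ j = k ∧ k = l then (2 * excess Q : ℂ) else 0) := by
  obtain ⟨p, hp⟩ : ∃ p : Fin n → ℕ,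
      ∀ a, p a = (if i = a then 1 else 0) + (if k = a then 1 else 0) := ⟨_, fun _ => rfl⟩
  obtain ⟨q, hq⟩ : ∃ q : Fin n → ℕ,
      ∀ a, q a = (if j = a then 1 else 0) + (if l = a then 1 else 0) := ⟨_, fun _ => rfl⟩
  have hpow : ∀ (c : Prop) [Decidable c] (z : ℂ), z ^ (if c then 1 else 0) = if c then z else 1 :=
    fun c _ z => by split_ifs <;> simp
  have hmono : ∀ ω, X r (e i) ω * X (e j) r ω * (X r (e k) ω * X (e l) r ω) =
      ∏ a, (X r (e a) ω ^ p a * X (e a) r ω ^ q a) := fun ω => by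
    simp only [hp, hq, pow_add, Finset.prod_mul_distrib, hpow, Finset.prod_ite_eq,
      Finset.mem_univ, if_true]
    ring
  simp only [hmono]
  rw [hX.integral_row_prod he hr]
  have hzero : ∀ a, p a ≠ q a → (p a = 0 ∨ q a = 0) →
      ∏ a, ∫ ω, X r (e a) ω ^ p a * X (e a) r ω ^ q a ∂P = 0 := fun a h h' => by
    refine Finset.prod_eq_zero (Finset.mem_univ a) (hX.integral_row_pow hQ (hr a) ?_ ?_ h h')
    · rw [hp]; split_ifs <;> norm_num
    · rw [hq]; split_ifs <;> norm_num
  have hone : i ≠ k → (∀ a, p a = q a) →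
      ∏ a, ∫ ω, X r (e a) ω ^ p a * X (e a) r ω ^ q a ∂P = 1 := fun hik h => by
    refine Finset.prod_eq_one fun a _ => ?_
    rw [← h a, hp]
    by_cases h1 : i = a
    · have h2 : k ≠ a := fun h2 => hik (h1.trans h2.symm)
      simpa [h1, h2] using hX.integral_entry_mul_swap hQ r (e a)
    · by_cases h2 : k = a
      · simpa [h1, h2] using hX.integral_entry_mul_swap hQ r (e a)
      · simp [h1, h2]
  by_cases h1 : i = j
  · subst h1
    by_cases h2 : k = l
    · subst h2
      by_cases h3 : i = k
      · subst h3
        have hp' : ∀ a, p a = if i = a then 2 else 0 := fun a => by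
          rw [hp]; split_ifs <;> rfl
        have hq' : ∀ a, q a = if i = a then 2 else 0 := fun a => by
          rw [hq]; split_ifs <;> rfl
        rw [Finset.prod_eq_single i]
        · simp only [hp', hq', if_true, ← mul_pow]
          rw [hX.integral_entry_mul_swap_sq hQ (hr i).symm]
          simp only [and_self, if_true]
          ring
        · intro a _ ha
          simp [hp', hq', ha.symm]
        · simp
      · rw [hone h3 fun a => by rw [hp, hq]]
        simp [h3]
    · by_cases h3 : i = k
      · subst h3
        rw [hzero l (by simp [hp, hq, h2]) (by simp [hp, hq, h2])]
        simp [h2]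
      · rw [hzero k (by simp [hp, hq, h3, Ne.symm h2]) (by simp [hp, hq, h3, Ne.symm h2])]
        simp [h2, h3]
  · by_cases h2 : i = l
    · subst h2
      by_cases h3 : j = k
      · subst h3
        rw [hone h1 fun a => by rw [hp, hq, add_comm]]
        simp [h1]
      · rw [hzero j (by simp [hp, hq, h1, Ne.symm h3]) (by simp [hp, hq, h1, Ne.symm h3])]
        simp [h1, h3]
    · rw [hzero i (by simp [hp, hq, Ne.symm h1, Ne.symm h2])
        (by simp [hp, hq, Ne.symm h1, Ne.symm h2])]
      simp [h1, h2]

end IsWignerArray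

/-! ### Domination of minors and differentiation under the integral -/

theorem Measurable.matrix_det {α : Type*} [MeasurableSpace α] {n : Type*} [Fintype n]
    [DecidableEq n] {A : α → Matrix n n ℂ} (h : ∀ i j, Measurable fun a => A a i j) :
    Measurable fun a => (A a).det := by
  simp only [Matrix.det_apply']
  exact Finset.measurable_fun_sum _ fun σ _ =>
    (Finset.measurable_fun_prod _ fun i _ => h (σ i) i).const_mul _

/-- The square submatrix of `X - x` with rows `r` and columns `c`. -/
noncomputable def shiftedMatrix {Ω : Type*} (X : ℕ → ℕ → Ω → ℂ) {m : ℕ} (r c : Fin m → ℕ) (x : ℝ)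
    (ω : Ω) : Matrix (Fin m) (Fin m) ℂ :=
  Matrix.of fun i j => X (r i) (c j) ω - if r i = c j then (x : ℂ) else 0

theorem shiftedMatrix_self {Ω : Type*} (X : ℕ → ℕ → Ω → ℂ) {m : ℕ} {e : Fin m → ℕ}
    (he : Function.Injective e) (x : ℝ) (ω : Ω) : shiftedMatrix X e e x ω =
      (Matrix.of fun i j => X (e i) (e j) ω) - (x : ℂ) • (1 : Matrix (Fin m) (Fin m) ℂ) := by
  ext i j
  simp [shiftedMatrix, Matrix.one_apply, he.eq_iff]

theorem adjugate_shiftedMatrix {Ω : Type*} (X : ℕ → ℕ → Ω → ℂ) {m : ℕ} (r c : Fin (m + 1) → ℕ)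
    (x : ℝ) (ω : Ω) (i j : Fin (m + 1)) : (shiftedMatrix X r c x ω).adjugate i j =
      (-1) ^ (j + i : ℕ) * (shiftedMatrix X (r ∘ j.succAbove) (c ∘ i.succAbove) x ω).det :=
  Matrix.adjugate_fin_succ_eq_det_submatrix _ i j

/-- A bound, uniform for `|x| ≤ R`, for the entries of `X - x` at the position `z`. -/
noncomputable def entryEnvelope {Ω : Type*} (X : ℕ → ℕ → Ω → ℂ) (R : ℝ) (z : Sym2 ℕ) (ω : Ω) : ℝ :=
  1 + |R| + ‖X z.inf z.sup ω‖

/-- A bound, up to constants, for the minors of the upper left `M × M` corner of `X - x`. -/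
noncomputable def minorEnvelope {Ω : Type*} (X : ℕ → ℕ → Ω → ℂ) (R : ℝ) (M : ℕ) (ω : Ω) : ℝ :=
  ∏ z ∈ (Finset.range M).sym2, entryEnvelope X R z ω ^ 2

theorem one_le_entryEnvelope {Ω : Type*} (X : ℕ → ℕ → Ω → ℂ) (R : ℝ) (z : Sym2 ℕ) (ω : Ω) :
    1 ≤ entryEnvelope X R z ω := by
  rw [entryEnvelope]
  have := abs_nonneg R
  have := norm_nonneg (X z.inf z.sup ω)
  linarith

theorem minorEnvelope_nonneg {Ω : Type*} (X : ℕ → ℕ → Ω → ℂ) (R : ℝ) (M : ℕ) (ω : Ω) :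
    0 ≤ minorEnvelope X R M ω :=
  Finset.prod_nonneg fun _ _ => sq_nonneg _

theorem one_le_minorEnvelope {Ω : Type*} (X : ℕ → ℕ → Ω → ℂ) (R : ℝ) (M : ℕ) (ω : Ω) :
    1 ≤ minorEnvelope X R M ω := by
  refine Finset.one_le_prod fun z _ => one_le_pow₀ (one_le_entryEnvelope X R z ω)

namespace IsWignerArray

variable {Ω : Type*} [mΩ : MeasurableSpace Ω] {P : Measure Ω} {Q : Measure ℝ}
  {X : ℕ → ℕ → Ω → ℂ}

theorem norm_apply_swap (hX : IsWignerArray Q P X) (i j : ℕ) (ω : Ω) :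
    ‖X j i ω‖ = ‖X i j ω‖ := by
  rw [hX.hermitian, norm_star]

theorem norm_shiftedMatrix_apply_le (hX : IsWignerArray Q P X) {m : ℕ} (r c : Fin m → ℕ)
    {x R : ℝ} (hx : |x| ≤ R) (ω : Ω) (i j : Fin m) :
    ‖shiftedMatrix X r c x ω i j‖ ≤ entryEnvelope X R s(r i, c j) ω := by
  have h1 : ‖X (r i) (c j) ω‖ = ‖X s(r i, c j).inf s(r i, c j).sup ω‖ := by
    simp only [Sym2.inf_mk, Sym2.sup_mk]
    rcases le_total (r i) (c j) with h | h
    · rw [inf_eq_left.2 h, sup_eq_right.2 h]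
    · rw [inf_eq_right.2 h, sup_eq_left.2 h, hX.norm_apply_swap]
  have h2 : ‖(if r i = c j then (x : ℂ) else 0)‖ ≤ |R| := by
    split_ifs
    · rw [Complex.norm_real, Real.norm_eq_abs]
      exact hx.trans (le_abs_self R)
    · simp
  rw [shiftedMatrix, Matrix.of_apply, entryEnvelope, ← h1]
  have := norm_sub_le (X (r i) (c j) ω) (if r i = c j then (x : ℂ) else 0)
  linarith

/-- A Leibniz term uses each row once, so it meets an unordered position at most twice, which
explains the squares in `minorEnvelope`. Factors at unused positions are at least `1`. -/
theorem norm_det_shiftedMatrix_le (hX : IsWignerArray Q P X) {m M : ℕ} {r c : Fin m → ℕ}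
    (hr : Function.Injective r) (hrM : ∀ i, r i < M) (hcM : ∀ i, c i < M) {x R : ℝ}
    (hx : |x| ≤ R) (ω : Ω) :
    ‖(shiftedMatrix X r c x ω).det‖ ≤ m.factorial * minorEnvelope X R M ω := by
  have key : ∀ σ : Equiv.Perm (Fin m), ‖∏ i, shiftedMatrix X r c x ω (σ i) i‖ ≤
      minorEnvelope X R M ω := fun σ => by
    rw [norm_prod]
    have h1 : ∏ i, ‖shiftedMatrix X r c x ω (σ i) i‖ ≤
        ∏ i, entryEnvelope X R s(r (σ i), c i) ω :=
      Finset.prod_le_prod (fun _ _ => norm_nonneg _)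
        fun i _ => hX.norm_shiftedMatrix_apply_le r c hx ω (σ i) i
    refine h1.trans ?_
    rw [minorEnvelope, ← Finset.prod_fiberwise_of_maps_to (t := (Finset.range M).sym2)
      (g := fun i => s(r (σ i), c i)) (fun i _ => by simp [hrM, hcM])]
    refine Finset.prod_le_prod (fun z _ => Finset.prod_nonneg fun i _ =>
      zero_le_one.trans (one_le_entryEnvelope X R _ ω)) fun z _ => ?_
    rw [Finset.prod_congr rfl fun i hi => by rw [(Finset.mem_filter.1 hi).2],
      Finset.prod_const]
    refine pow_le_pow_right₀ (one_le_entryEnvelope X R z ω) ?_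
    induction z using Sym2.ind with
    | _ a b =>
      refine (Finset.card_le_card_of_injOn (fun i => r (σ i)) (t := {a, b}) (fun i hi => ?_)
        (hr.comp σ.injective).injOn).trans Finset.card_le_two
      have := (Finset.mem_filter.1 hi).2
      rcases Sym2.eq_iff.1 this with ⟨h, -⟩ | ⟨h, -⟩ <;> simp [h]
  rw [Matrix.det_apply]
  refine (norm_sum_le _ _).trans ((Finset.sum_le_sum
    (g := fun _ => minorEnvelope X R M ω) fun σ _ => ?_).trans_eq ?_)
  · rcases Int.units_eq_one_or (Equiv.Perm.sign σ) with h | h <;> simp only [h, one_smul,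
      Units.neg_smul, norm_neg] <;> exact key σ
  · simp [Fintype.card_perm]

theorem norm_adjugate_shiftedMatrix_le (hX : IsWignerArray Q P X) {m M : ℕ} {r c : Fin m → ℕ}
    (hr : Function.Injective r) (hrM : ∀ i, r i < M) (hcM : ∀ i, c i < M) {x R : ℝ}
    (hx : |x| ≤ R) (ω : Ω) (i j : Fin m) :
    ‖(shiftedMatrix X r c x ω).adjugate i j‖ ≤ m.factorial * minorEnvelope X R M ω := by
  rcases m with _ | m
  · exact i.elim0
  rw [adjugate_shiftedMatrix, norm_mul, norm_pow, norm_neg, norm_one, one_pow, one_mul]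
  refine (hX.norm_det_shiftedMatrix_le (hr.comp Fin.succAbove_right_injective)
    (fun _ => hrM _) (fun _ => hcM _) hx ω).trans ?_
  have := minorEnvelope_nonneg X R M ω
  gcongr
  exact Nat.le_succ m

theorem norm_trace_adjugate_shiftedMatrix_le (hX : IsWignerArray Q P X) {m M : ℕ}
    {r c : Fin m → ℕ} (hr : Function.Injective r) (hrM : ∀ i, r i < M) (hcM : ∀ i, c i < M)
    {x R : ℝ} (hx : |x| ≤ R) (ω : Ω) :
    ‖(shiftedMatrix X r c x ω).adjugate.trace‖ ≤
      (m * m.factorial) * minorEnvelope X R M ω := by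
  refine (norm_sum_le _ _).trans ((Finset.sum_le_sum fun i _ =>
    hX.norm_adjugate_shiftedMatrix_le hr hrM hcM hx ω i i).trans_eq ?_)
  simp [mul_assoc]

theorem measurable_det_shiftedMatrix (hX : IsWignerArray Q P X) {m : ℕ} {r c : Fin m → ℕ}
    (x : ℝ) {E : Set (Sym2 ℕ)} (hE : ∀ i j, s(r i, c j) ∈ E) :
    Measurable[edgeAlgebra X E] fun ω => (shiftedMatrix X r c x ω).det :=
  @Measurable.matrix_det _ (edgeAlgebra X E) _ _ _ _ fun i j =>
    (hX.measurable_edgeAlgebra (hE i j)).sub_const _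

theorem measurable_adjugate_shiftedMatrix (hX : IsWignerArray Q P X) {m : ℕ} {r c : Fin m → ℕ}
    (x : ℝ) {E : Set (Sym2 ℕ)} (hE : ∀ i j, s(r i, c j) ∈ E) (i j : Fin m) :
    Measurable[edgeAlgebra X E] fun ω => (shiftedMatrix X r c x ω).adjugate i j := by
  rcases m with _ | m
  · exact i.elim0
  simp only [adjugate_shiftedMatrix]
  exact (hX.measurable_det_shiftedMatrix x fun a b => hE _ _).const_mul _

theorem measurable_trace_adjugate_shiftedMatrix (hX : IsWignerArray Q P X) {m : ℕ}
    {r c : Fin m → ℕ} (x : ℝ) {E : Set (Sym2 ℕ)} (hE : ∀ i j, s(r i, c j) ∈ E) :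
    Measurable[edgeAlgebra X E] fun ω => (shiftedMatrix X r c x ω).adjugate.trace :=
  Finset.measurable_fun_sum _ fun i _ => hX.measurable_adjugate_shiftedMatrix x hE i i

theorem measurable_of_edgeAlgebra (hX : IsWignerArray Q P X) {E : Set (Sym2 ℕ)} {f : Ω → ℂ}
    (hf : Measurable[edgeAlgebra X E] f) : Measurable f :=
  hf.mono (hX.edgeAlgebra_le _) le_rfl

/-- The square is a product of fourth powers over distinct positions. These are independent, so
finite fourth moments suffice, and products of two minors of any size are integrable. -/
theorem integrable_sq_minorEnvelope (hX : IsWignerArray Q P X) [IsProbabilityMeasure P]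
    (hQ : WignerMoments Q) (R : ℝ) (M : ℕ) :
    Integrable (fun ω => minorEnvelope X R M ω ^ 2) P := by
  have h := hX.integrable_prod (Finset.range M).sym2 (E := id) Function.injective_id
    (φ := fun z ω => ((entryEnvelope X R z ω ^ 4 : ℝ) : ℂ)) (fun z _ => ?_) (fun z _ => ?_)
  · refine h.norm.congr (ae_of_all _ fun ω => ?_)
    simp only
    rw [← Complex.ofReal_prod, Complex.norm_real, minorEnvelope, ← Finset.prod_pow,
      Real.norm_of_nonneg (Finset.prod_nonneg fun z _ => by positivity)]
    exact Finset.prod_congr rfl fun z _ => by ring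
  · have hz : s(z.inf, z.sup) = z := by
      induction z using Sym2.ind with
      | _ a b =>
        simp only [Sym2.inf_mk, Sym2.sup_mk]
        rcases le_total a b with h | h
        · rw [inf_eq_left.2 h, sup_eq_right.2 h]
        · rw [inf_eq_right.2 h, sup_eq_left.2 h, Sym2.eq_swap]
    have h1 : Measurable[edgeAlgebra X {id z}] (X z.inf z.sup) :=
      hX.measurable_edgeAlgebra (by rw [hz]; exact Set.mem_singleton _)
    exact Complex.measurable_ofReal.comp
      (((continuous_norm.measurable.comp h1).const_add (1 + |R|)).pow_const 4)
  · refine Integrable.ofReal (𝕜 := ℂ) ?_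
    have h4 := hX.integrable_norm_entry_pow_four hQ z.inf z.sup
    -- The constant is `8 = 2 ^ (4 - 1)` from the convexity bound for `(a + b) ^ 4`.
    refine (((integrable_const ((1 + |R|) ^ 4)).add h4).const_mul 8).mono'
      (((hX.measurable_entry _ _).norm.const_add (1 + |R|)).pow_const 4).aestronglyMeasurable
      (ae_of_all _ fun ω => ?_)
    have h0 : 0 ≤ 1 + |R| := by positivity
    change ‖entryEnvelope X R z ω ^ 4‖ ≤ _
    rw [Real.norm_of_nonneg (pow_nonneg (zero_le_one.trans (one_le_entryEnvelope X R z ω)) 4),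
      entryEnvelope]
    exact (add_pow_le h0 (norm_nonneg _) 4).trans_eq (by norm_num)

theorem integrable_of_norm_le (hX : IsWignerArray Q P X) [IsProbabilityMeasure P]
    (hQ : WignerMoments Q) {f : Ω → ℂ} (hf : Measurable f) {R C : ℝ} {M : ℕ}
    (h : ∀ ω, ‖f ω‖ ≤ C * minorEnvelope X R M ω ^ 2) : Integrable f P :=
  ((hX.integrable_sq_minorEnvelope hQ R M).const_mul C).mono' hf.aestronglyMeasurable
    (ae_of_all _ h)

theorem integrable_mul_of_norm_le (hX : IsWignerArray Q P X) [IsProbabilityMeasure P]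
    (hQ : WignerMoments Q) {f g : Ω → ℂ} (hf : Measurable f) (hg : Measurable g) {R C D : ℝ}
    (hC : 0 ≤ C) {M : ℕ} (hfC : ∀ ω, ‖f ω‖ ≤ C * minorEnvelope X R M ω)
    (hgD : ∀ ω, ‖g ω‖ ≤ D * minorEnvelope X R M ω) : Integrable (fun ω => f ω * g ω) P := by
  refine hX.integrable_of_norm_le hQ (hf.mul hg) (R := R) (C := C * D) (M := M) fun ω => ?_
  rw [norm_mul]
  have := minorEnvelope_nonneg X R M ω
  calc ‖f ω‖ * ‖g ω‖ ≤ (C * minorEnvelope X R M ω) * (D * minorEnvelope X R M ω) :=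
      mul_le_mul (hfC ω) (hgD ω) (norm_nonneg _) (by positivity)
    _ = _ := by ring

/-- Differentiation of a characteristic polynomial under the integral sign. -/
theorem hasDerivAt_integral_det_mul (hX : IsWignerArray Q P X) [IsProbabilityMeasure P]
    (hQ : WignerMoments Q) {m M : ℕ} {e : Fin m → ℕ} (he : Function.Injective e)
    (hM : ∀ i, e i < M) {g : Ω → ℂ} (hg : Measurable g) {D : ℝ} (R₀ : ℝ)
    (hgD : ∀ R, R₀ ≤ R → ∀ ω, ‖g ω‖ ≤ D * minorEnvelope X R M ω) (x : ℝ) :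
    HasDerivAt (fun x => ∫ ω, (shiftedMatrix X e e x ω).det * g ω ∂P)
      (∫ ω, -(shiftedMatrix X e e x ω).adjugate.trace * g ω ∂P) x := by
  -- A single envelope must bound `g` and, uniformly over the unit ball around `x`, the determinant
  -- and the trace of its adjugate.
  obtain ⟨R, hR₀, hRx⟩ : ∃ R, R₀ ≤ R ∧ |x| + 1 ≤ R :=
    ⟨max R₀ (|x| + 1), le_max_left _ _, le_max_right _ _⟩
  have hball : ∀ y ∈ Metric.ball x 1, |y| ≤ R := fun y hy => by
    rw [Metric.mem_ball, Real.dist_eq] at hy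
    have := abs_sub_abs_le_abs_sub y x
    linarith
  have hdet : ∀ y, Measurable fun ω => (shiftedMatrix X e e y ω).det := fun y =>
    hX.measurable_of_edgeAlgebra (hX.measurable_det_shiftedMatrix y fun _ _ => Set.mem_univ _)
  have htr : ∀ y, Measurable fun ω => (shiftedMatrix X e e y ω).adjugate.trace := fun y =>
    hX.measurable_of_edgeAlgebra
      (hX.measurable_trace_adjugate_shiftedMatrix y fun _ _ => Set.mem_univ _)
  refine (hasDerivAt_integral_of_dominated_loc_of_deriv_le (s := Metric.ball x 1)
    (bound := fun ω => (m * m.factorial * D) * minorEnvelope X R M ω ^ 2)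
    (F' := fun y ω => -(shiftedMatrix X e e y ω).adjugate.trace * g ω)
    (Metric.ball_mem_nhds x one_pos)
    (Eventually.of_forall fun y => ((hdet y).mul hg).aestronglyMeasurable)
    (hX.integrable_mul_of_norm_le hQ (hdet x) hg (by positivity)
      (fun ω => hX.norm_det_shiftedMatrix_le he hM hM
        (hball x (Metric.mem_ball_self one_pos)) ω) (hgD R hR₀))
    ((htr x).neg.mul hg).aestronglyMeasurable
    (ae_of_all _ fun ω y hy => ?_)
    ((hX.integrable_sq_minorEnvelope hQ R M).const_mul _)
    (ae_of_all _ fun ω y _ => ?_)).2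
  · rw [norm_mul, norm_neg]
    have := minorEnvelope_nonneg X R M ω
    calc _ ≤ (m * m.factorial * minorEnvelope X R M ω) * (D * minorEnvelope X R M ω) :=
        mul_le_mul (hX.norm_trace_adjugate_shiftedMatrix_le he hM hM (hball y hy) ω)
          (hgD R hR₀ ω) (norm_nonneg _) (by positivity)
      _ = _ := by ring
  · simp only [shiftedMatrix_self X he]
    exact (Matrix.hasDerivAt_det_sub_smul_one _ y).mul_const _

end IsWignerArray

/-! ### Averaging over one row -/

/-- The quadratic form of the adjugate of `X - x` on the indices `e`, evaluated at the row `r`. -/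
noncomputable def rowForm {Ω : Type*} (X : ℕ → ℕ → Ω → ℂ) {n : ℕ} (e : Fin n → ℕ) (r : ℕ) (x : ℝ)
    (ω : Ω) : ℂ :=
  ∑ i, ∑ j, X r (e i) ω * X (e j) r ω * (shiftedMatrix X e e x ω).adjugate i j

/-- The shift touches only the diagonal, so the rest of the row `e 0` consists of plain entries, and
the determinant and adjugate of the remaining minor are independent of that row. -/
theorem det_shiftedMatrix_succ {Ω : Type*} (X : ℕ → ℕ → Ω → ℂ) {n : ℕ} {e : Fin (n + 1) → ℕ}
    (he : Function.Injective e) (x : ℝ) (ω : Ω) : (shiftedMatrix X e e x ω).det =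
      (X (e 0) (e 0) ω - x) * (shiftedMatrix X (e ∘ Fin.succ) (e ∘ Fin.succ) x ω).det -
        rowForm X (e ∘ Fin.succ) (e 0) x ω := by
  rw [Matrix.det_succ_eq_sub_sum_adjugate]
  congr 1
  · rw [show shiftedMatrix X e e x ω 0 0 = X (e 0) (e 0) ω - x by simp [shiftedMatrix]]
    rfl
  · refine Finset.sum_congr rfl fun i _ => Finset.sum_congr rfl fun j _ => ?_
    rw [show shiftedMatrix X e e x ω 0 i.succ = X (e 0) (e i.succ) ω by
        simp [shiftedMatrix, he.eq_iff, (Fin.succ_ne_zero i).symm],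
      show shiftedMatrix X e e x ω j.succ 0 = X (e j.succ) (e 0) ω by
        simp [shiftedMatrix, he.eq_iff, Fin.succ_ne_zero j], mul_right_comm]
    rfl

/-- Contraction with the moments of `integral_row_four`; for `G` a product of two adjugate entries
the sums are the product of traces, the trace of the product and the diagonal sum. -/
theorem sum_pairing_mul {ι : Type*} [Fintype ι] [DecidableEq ι] (c : ℂ)
    (G : ι → ι → ι → ι → ℂ) :
    ∑ i, ∑ j, ∑ k, ∑ l, ((if i = j ∧ k = l then 1 else 0) + (if i = l ∧ j = k then 1 else 0) +
        (if i = j ∧ j = k ∧ k = l then c else 0)) * G i j k l =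
      ∑ i, ∑ k, G i i k k + ∑ i, ∑ j, G i j j i + ∑ i, c * G i i i i := by
  simp only [add_mul, Finset.sum_add_distrib, ite_and, ite_mul, one_mul, zero_mul,
    Finset.sum_ite_irrel, Finset.sum_const_zero, Finset.sum_ite_eq, Finset.mem_univ, if_true]

theorem integrable_mul_four {Ω : Type*} [MeasurableSpace Ω] {P : Measure Ω}
    {f₁ f₂ f₃ f₄ : Ω → ℂ} (h₁ : MemLp f₁ 4 P) (h₂ : MemLp f₂ 4 P) (h₃ : MemLp f₃ 4 P)
    (h₄ : MemLp f₄ 4 P) : Integrable (fun ω => f₁ ω * f₂ ω * (f₃ ω * f₄ ω)) P := by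
  have : ENNReal.HolderTriple 4 4 2 := ⟨by
    rw [← two_mul, show (4 : ENNReal) = 2 * 2 by norm_num, ENNReal.mul_inv (by simp) (by simp),
      ← mul_assoc, ENNReal.mul_inv_cancel (by simp) (by simp), one_mul]⟩
  have h12 : MemLp (fun ω => f₁ ω * f₂ ω) 2 P := h₂.mul' h₁
  have h34 : MemLp (fun ω => f₃ ω * f₄ ω) 2 P := h₄.mul' h₃
  exact h12.integrable_mul h34

theorem disjoint_mem_notMem_sym2 (r : ℕ) : Disjoint {z : Sym2 ℕ | r ∈ z} {z : Sym2 ℕ | r ∉ z} :=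
  Set.disjoint_left.2 fun _ h h' => h' h

namespace IsWignerArray

variable {Ω : Type*} [mΩ : MeasurableSpace Ω] {P : Measure Ω} {Q : Measure ℝ}
  {X : ℕ → ℕ → Ω → ℂ} {n : ℕ} {e : Fin n → ℕ} {r : ℕ}

theorem measurable_row (hX : IsWignerArray Q P X) (i : ℕ) :
    Measurable[edgeAlgebra X {z | r ∈ z}] (X r i) := hX.measurable_edgeAlgebra (by simp)

theorem measurable_column (hX : IsWignerArray Q P X) (i : ℕ) :
    Measurable[edgeAlgebra X {z | r ∈ z}] (X i r) := hX.measurable_edgeAlgebra (by simp)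

theorem measurable_det_off (hX : IsWignerArray Q P X) (hr : ∀ i, e i ≠ r) (x : ℝ) :
    Measurable[edgeAlgebra X {z | r ∉ z}] fun ω => (shiftedMatrix X e e x ω).det :=
  hX.measurable_det_shiftedMatrix x fun i j => by simp [(hr i).symm, (hr j).symm]

theorem measurable_adjugate_off (hX : IsWignerArray Q P X) (hr : ∀ i, e i ≠ r) (x : ℝ)
    (i j : Fin n) : Measurable[edgeAlgebra X {z | r ∉ z}]
      fun ω => (shiftedMatrix X e e x ω).adjugate i j :=
  hX.measurable_adjugate_shiftedMatrix x (fun i j => by simp [(hr i).symm, (hr j).symm]) i j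

theorem measurable_det (hX : IsWignerArray Q P X) (e : Fin n → ℕ) (x : ℝ) :
    Measurable fun ω => (shiftedMatrix X e e x ω).det :=
  hX.measurable_of_edgeAlgebra (hX.measurable_det_shiftedMatrix x fun _ _ => Set.mem_univ _)

theorem measurable_adjugate (hX : IsWignerArray Q P X) (e : Fin n → ℕ) (x : ℝ) (i j : Fin n) :
    Measurable fun ω => (shiftedMatrix X e e x ω).adjugate i j :=
  hX.measurable_of_edgeAlgebra
    (hX.measurable_adjugate_shiftedMatrix x (fun _ _ => Set.mem_univ _) i j)

theorem measurable_trace_adjugate (hX : IsWignerArray Q P X) (e : Fin n → ℕ) (x : ℝ) :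
    Measurable fun ω => (shiftedMatrix X e e x ω).adjugate.trace :=
  hX.measurable_of_edgeAlgebra
    (hX.measurable_trace_adjugate_shiftedMatrix x fun _ _ => Set.mem_univ _)

theorem integral_row_mul_off (hX : IsWignerArray Q P X) {f g : Ω → ℂ}
    (hf : Measurable[edgeAlgebra X {z | r ∈ z}] f) (hg : Measurable[edgeAlgebra X {z | r ∉ z}] g) :
    ∫ ω, f ω * g ω ∂P = (∫ ω, f ω ∂P) * ∫ ω, g ω ∂P :=
  hX.integral_mul_of_disjoint (disjoint_mem_notMem_sym2 r) hf hg

theorem integrable_row_mul_off (hX : IsWignerArray Q P X) {f g : Ω → ℂ}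
    (hf : Measurable[edgeAlgebra X {z | r ∈ z}] f) (hg : Measurable[edgeAlgebra X {z | r ∉ z}] g)
    (hfi : Integrable f P) (hgi : Integrable g P) : Integrable (fun ω => f ω * g ω) P :=
  hX.integrable_mul_of_disjoint (disjoint_mem_notMem_sym2 r) hf hg hfi hgi

variable [IsProbabilityMeasure P]

theorem integrable_det_mul_det (hX : IsWignerArray Q P X) (hQ : WignerMoments Q)
    (he : Function.Injective e) (x y : ℝ) :
    Integrable (fun ω => (shiftedMatrix X e e x ω).det * (shiftedMatrix X e e y ω).det) P := by
  obtain ⟨M, hM⟩ : ∃ M, ∀ i, e i < M := ⟨Finset.univ.sup e + 1, fun i =>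
    Nat.lt_succ_of_le (Finset.le_sup (Finset.mem_univ i))⟩
  exact hX.integrable_mul_of_norm_le hQ (hX.measurable_det e x) (hX.measurable_det e y)
    (R := max |x| |y|) (Nat.cast_nonneg _)
    (hX.norm_det_shiftedMatrix_le he hM hM (le_max_left _ _))
    (hX.norm_det_shiftedMatrix_le he hM hM (le_max_right _ _))

theorem integrable_det_mul_adjugate (hX : IsWignerArray Q P X) (hQ : WignerMoments Q)
    (he : Function.Injective e) (x y : ℝ) (i j : Fin n) :
    Integrable (fun ω => (shiftedMatrix X e e x ω).det * (shiftedMatrix X e e y ω).adjugate i j)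
      P := by
  obtain ⟨M, hM⟩ : ∃ M, ∀ i, e i < M := ⟨Finset.univ.sup e + 1, fun i =>
    Nat.lt_succ_of_le (Finset.le_sup (Finset.mem_univ i))⟩
  exact hX.integrable_mul_of_norm_le hQ (hX.measurable_det e x) (hX.measurable_adjugate e y i j)
    (R := max |x| |y|) (Nat.cast_nonneg _)
    (hX.norm_det_shiftedMatrix_le he hM hM (le_max_left _ _))
    (fun ω => hX.norm_adjugate_shiftedMatrix_le he hM hM (le_max_right _ _) ω i j)

theorem integrable_adjugate_mul_adjugate (hX : IsWignerArray Q P X) (hQ : WignerMoments Q)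
    (he : Function.Injective e) (x y : ℝ) (i j k l : Fin n) :
    Integrable (fun ω => (shiftedMatrix X e e x ω).adjugate i j *
      (shiftedMatrix X e e y ω).adjugate k l) P := by
  obtain ⟨M, hM⟩ : ∃ M, ∀ i, e i < M := ⟨Finset.univ.sup e + 1, fun i =>
    Nat.lt_succ_of_le (Finset.le_sup (Finset.mem_univ i))⟩
  exact hX.integrable_mul_of_norm_le hQ (hX.measurable_adjugate e x i j)
    (hX.measurable_adjugate e y k l) (R := max |x| |y|) (Nat.cast_nonneg _)
    (fun ω => hX.norm_adjugate_shiftedMatrix_le he hM hM (le_max_left _ _) ω i j)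
    (fun ω => hX.norm_adjugate_shiftedMatrix_le he hM hM (le_max_right _ _) ω k l)

theorem integrable_det (hX : IsWignerArray Q P X) (hQ : WignerMoments Q)
    (he : Function.Injective e) (x : ℝ) :
    Integrable (fun ω => (shiftedMatrix X e e x ω).det) P := by
  obtain ⟨M, hM⟩ : ∃ M, ∀ i, e i < M := ⟨Finset.univ.sup e + 1, fun i =>
    Nat.lt_succ_of_le (Finset.le_sup (Finset.mem_univ i))⟩
  have := hX.integrable_mul_of_norm_le hQ (hX.measurable_det e x) (measurable_const (a := (1 : ℂ)))
    (R := |x|) (D := 1) (Nat.cast_nonneg _) (hX.norm_det_shiftedMatrix_le he hM hM le_rfl)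
    (fun ω => by simpa using one_le_minorEnvelope X |x| M ω)
  simpa using this

theorem integrable_adjugate (hX : IsWignerArray Q P X) (hQ : WignerMoments Q)
    (he : Function.Injective e) (x : ℝ) (i j : Fin n) :
    Integrable (fun ω => (shiftedMatrix X e e x ω).adjugate i j) P := by
  obtain ⟨M, hM⟩ : ∃ M, ∀ i, e i < M := ⟨Finset.univ.sup e + 1, fun i =>
    Nat.lt_succ_of_le (Finset.le_sup (Finset.mem_univ i))⟩
  have := hX.integrable_mul_of_norm_le hQ (hX.measurable_adjugate e x i j)
    (measurable_const (a := (1 : ℂ))) (R := |x|) (D := 1) (Nat.cast_nonneg _)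
    (fun ω => hX.norm_adjugate_shiftedMatrix_le he hM hM le_rfl ω i j)
    (fun ω => by simpa using one_le_minorEnvelope X |x| M ω)
  simpa using this

theorem integral_diag_mul_diag (hX : IsWignerArray Q P X) (hQ : WignerMoments Q) (r : ℕ)
    (x y : ℝ) : ∫ ω, (X r r ω - x) * (X r r ω - y) ∂P = 1 + x * y := by
  have h4 := hX.memLp_entry hQ r r
  have h1 : Integrable (X r r) P := h4.integrable (by norm_num)
  have h2 : Integrable (fun ω => X r r ω * X r r ω) P := by
    simpa using integrable_mul_four h4 h4 (memLp_const (1 : ℂ)) (memLp_const (1 : ℂ))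
  have : ∀ ω, (X r r ω - x) * (X r r ω - y) = X r r ω * X r r ω - (x + y) * X r r ω + x * y :=
    fun ω => by ring
  simp only [this]
  rw [integral_add (f := fun ω => X r r ω * X r r ω - (x + y) * X r r ω)
      (h2.sub (h1.const_mul _)) (integrable_const _), integral_sub h2 (h1.const_mul _),
    hX.integral_entry_mul_swap hQ, integral_const_mul,
    hX.integral_entry hQ]
  simp

theorem integral_diag_mul_row (hX : IsWignerArray Q P X) (hQ : WignerMoments Q)
    (he : Function.Injective e) (hr : ∀ i, e i ≠ r) (x : ℝ) (i j : Fin n) :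
    ∫ ω, (X r r ω - x) * (X r (e i) ω * X (e j) r ω) ∂P = if i = j then (-x : ℂ) else 0 := by
  have h4 := hX.memLp_entry hQ r r
  have hi := hX.memLp_entry hQ r (e i)
  have hj := hX.memLp_entry hQ (e j) r
  have h1 : Integrable (fun ω => X r (e i) ω * X (e j) r ω) P := by
    simpa using integrable_mul_four hi hj (memLp_const (1 : ℂ)) (memLp_const (1 : ℂ))
  have h2 : Integrable (fun ω => X r r ω * (X r (e i) ω * X (e j) r ω)) P := by
    simpa using integrable_mul_four h4 (memLp_const (1 : ℂ)) hi hj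
  simp only [sub_mul]
  rw [integral_sub h2 (h1.const_mul _), integral_const_mul, hX.integral_row_mul_row hQ he hr,
    hX.integral_mul_of_disjoint (E := {s(r, r)}) (F := {s(r, r)}ᶜ)
      (g := fun ω => X r (e i) ω * X (e j) r ω) disjoint_compl_right
      (hX.measurable_edgeAlgebra (Set.mem_singleton _))
      ((hX.measurable_edgeAlgebra (by simp [hr])).mul (hX.measurable_edgeAlgebra (by simp [hr]))),
    hX.integral_entry hQ]
  split_ifs <;> simp

theorem hasIntegral_diag_det (hX : IsWignerArray Q P X) (hQ : WignerMoments Q)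
    (he : Function.Injective e) (hr : ∀ i, e i ≠ r) (x y : ℝ) :
    Integrable (fun ω => (X r r ω - x) * (shiftedMatrix X e e x ω).det *
        ((X r r ω - y) * (shiftedMatrix X e e y ω).det)) P ∧
      ∫ ω, (X r r ω - x) * (shiftedMatrix X e e x ω).det *
        ((X r r ω - y) * (shiftedMatrix X e e y ω).det) ∂P =
      (1 + x * y) * ∫ ω, (shiftedMatrix X e e x ω).det * (shiftedMatrix X e e y ω).det ∂P := by
  have hd : ∀ x : ℝ, MemLp (fun ω => X r r ω - x) 4 P := fun x =>
    (hX.memLp_entry hQ r r).sub (memLp_const _)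
  have hm : Measurable[edgeAlgebra X {z | r ∈ z}] fun ω => (X r r ω - x) * (X r r ω - y) :=
    ((hX.measurable_row r).sub_const _).mul ((hX.measurable_row r).sub_const _)
  have hdd : Measurable[edgeAlgebra X {z | r ∉ z}] fun ω =>
      (shiftedMatrix X e e x ω).det * (shiftedMatrix X e e y ω).det :=
    (hX.measurable_det_off hr x).mul (hX.measurable_det_off hr y)
  simp only [mul_mul_mul_comm (_ - (x : ℂ))]
  refine ⟨hX.integrable_row_mul_off hm hdd ?_ (hX.integrable_det_mul_det hQ he x y), ?_⟩
  · simpa using integrable_mul_four (hd x) (hd y) (memLp_const (1 : ℂ)) (memLp_const (1 : ℂ))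
  · rw [hX.integral_row_mul_off hm hdd, hX.integral_diag_mul_diag hQ]

/-- Averaging over row `r` turns the quadratic form into the trace of the adjugate, and the centered
diagonal entry leaves only `-x`. -/
theorem hasIntegral_diag_rowForm (hX : IsWignerArray Q P X) (hQ : WignerMoments Q)
    (he : Function.Injective e) (hr : ∀ i, e i ≠ r) (x y : ℝ) :
    Integrable (fun ω => (X r r ω - x) * (shiftedMatrix X e e x ω).det * rowForm X e r y ω) P ∧
      ∫ ω, (X r r ω - x) * (shiftedMatrix X e e x ω).det * rowForm X e r y ω ∂P =
      -x * ∫ ω, (shiftedMatrix X e e x ω).det * (shiftedMatrix X e e y ω).adjugate.trace ∂P := by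
  have hd : MemLp (fun ω => X r r ω - x) 4 P := (hX.memLp_entry hQ r r).sub (memLp_const _)
  have hm : ∀ i j, Measurable[edgeAlgebra X {z | r ∈ z}]
      fun ω => (X r r ω - x) * (X r (e i) ω * X (e j) r ω) := fun i j =>
    ((hX.measurable_row r).sub_const _).mul
      ((hX.measurable_row (e i)).mul (hX.measurable_column (e j)))
  have hg : ∀ i j, Measurable[edgeAlgebra X {z | r ∉ z}]
      fun ω => (shiftedMatrix X e e x ω).det * (shiftedMatrix X e e y ω).adjugate i j :=
    fun i j => (hX.measurable_det_off hr x).mul (hX.measurable_adjugate_off hr y i j)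
  have hi : ∀ i j, Integrable (fun ω => (X r r ω - x) * (X r (e i) ω * X (e j) r ω) *
      ((shiftedMatrix X e e x ω).det * (shiftedMatrix X e e y ω).adjugate i j)) P := fun i j => by
    refine hX.integrable_row_mul_off (hm i j) (hg i j) ?_
      (hX.integrable_det_mul_adjugate hQ he x y i j)
    simpa using integrable_mul_four hd (memLp_const (1 : ℂ)) (hX.memLp_entry hQ r (e i))
      (hX.memLp_entry hQ (e j) r)
  have hsum : ∀ ω, (X r r ω - x) * (shiftedMatrix X e e x ω).det * rowForm X e r y ω =
      ∑ i, ∑ j, (X r r ω - x) * (X r (e i) ω * X (e j) r ω) *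
        ((shiftedMatrix X e e x ω).det * (shiftedMatrix X e e y ω).adjugate i j) := fun ω => by
    simp only [rowForm, Finset.mul_sum]
    exact Finset.sum_congr rfl fun i _ => Finset.sum_congr rfl fun j _ => by ring
  simp only [hsum]
  refine ⟨integrable_finsetSum _ fun i _ => integrable_finsetSum _ fun j _ => hi i j, ?_⟩
  rw [integral_finsetSum _ fun i _ => integrable_finsetSum _ fun j _ => hi i j]
  simp only [Matrix.trace, Matrix.diag_apply, Finset.mul_sum]
  rw [integral_finsetSum _ fun i _ => hX.integrable_det_mul_adjugate hQ he x y i i,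
    Finset.mul_sum]
  refine Finset.sum_congr rfl fun i _ => ?_
  rw [integral_finsetSum _ fun j _ => hi i j, Finset.sum_eq_single i]
  · rw [hX.integral_row_mul_off (hm i i) (hg i i), hX.integral_diag_mul_row hQ he hr, if_pos rfl]
  · intro j _ hj
    rw [hX.integral_row_mul_off (hm i j) (hg i j), hX.integral_diag_mul_row hQ he hr,
      if_neg hj.symm, zero_mul]
  · simp

theorem hasIntegral_rowForm_mul_rowForm (hX : IsWignerArray Q P X) (hQ : WignerMoments Q)
    (he : Function.Injective e) (hr : ∀ i, e i ≠ r) (x y : ℝ) :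
    Integrable (fun ω => rowForm X e r x ω * rowForm X e r y ω) P ∧
      ∫ ω, rowForm X e r x ω * rowForm X e r y ω ∂P =
      ∫ ω, (shiftedMatrix X e e x ω).adjugate.trace *
          (shiftedMatrix X e e y ω).adjugate.trace ∂P +
        ∫ ω, ((shiftedMatrix X e e x ω).adjugate * (shiftedMatrix X e e y ω).adjugate).trace ∂P +
        2 * excess Q * ∑ i, ∫ ω, (shiftedMatrix X e e x ω).adjugate i i *
          (shiftedMatrix X e e y ω).adjugate i i ∂P := by
  have hm : ∀ i j k l, Measurable[edgeAlgebra X {z | r ∈ z}]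
      fun ω => X r (e i) ω * X (e j) r ω * (X r (e k) ω * X (e l) r ω) := fun i j k l =>
    ((hX.measurable_row (e i)).mul (hX.measurable_column (e j))).mul
      ((hX.measurable_row (e k)).mul (hX.measurable_column (e l)))
  have hg : ∀ i j k l, Measurable[edgeAlgebra X {z | r ∉ z}]
      fun ω => (shiftedMatrix X e e x ω).adjugate i j * (shiftedMatrix X e e y ω).adjugate k l :=
    fun i j k l => (hX.measurable_adjugate_off hr x i j).mul (hX.measurable_adjugate_off hr y k l)
  have hgi := hX.integrable_adjugate_mul_adjugate hQ he x y
  have hi : ∀ i j k l, Integrable (fun ω =>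
      X r (e i) ω * X (e j) r ω * (X r (e k) ω * X (e l) r ω) *
      ((shiftedMatrix X e e x ω).adjugate i j * (shiftedMatrix X e e y ω).adjugate k l)) P :=
    fun i j k l => hX.integrable_row_mul_off (hm i j k l) (hg i j k l)
      (integrable_mul_four (hX.memLp_entry hQ _ _) (hX.memLp_entry hQ _ _)
        (hX.memLp_entry hQ _ _) (hX.memLp_entry hQ _ _)) (hgi i j k l)
  have hsum : ∀ ω, rowForm X e r x ω * rowForm X e r y ω =
      ∑ i, ∑ j, ∑ k, ∑ l, X r (e i) ω * X (e j) r ω * (X r (e k) ω * X (e l) r ω) *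
      ((shiftedMatrix X e e x ω).adjugate i j * (shiftedMatrix X e e y ω).adjugate k l) :=
    fun ω => by
      simp only [rowForm]
      rw [Finset.sum_mul]
      refine Finset.sum_congr rfl fun i _ => ?_
      rw [Finset.sum_mul]
      refine Finset.sum_congr rfl fun j _ => ?_
      rw [Finset.mul_sum]
      refine Finset.sum_congr rfl fun k _ => ?_
      rw [Finset.mul_sum]
      exact Finset.sum_congr rfl fun l _ => by ring
  simp only [hsum]
  have hi1 := fun i j k => integrable_finsetSum Finset.univ fun l _ => hi i j k l
  have hi2 := fun i j => integrable_finsetSum Finset.univ fun k _ => hi1 i j k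
  have hi3 := fun i => integrable_finsetSum Finset.univ fun j _ => hi2 i j
  refine ⟨integrable_finsetSum _ fun i _ => hi3 i, ?_⟩
  rw [integral_finsetSum _ fun i _ => hi3 i]
  simp only [integral_finsetSum _ fun j _ => hi2 _ j, integral_finsetSum _ fun k _ => hi1 _ _ k,
    integral_finsetSum _ fun l _ => hi _ _ _ l, hX.integral_row_mul_off (hm _ _ _ _) (hg _ _ _ _),
    hX.integral_row_four hQ he hr]
  have ht1 : ∫ ω, (shiftedMatrix X e e x ω).adjugate.trace *
      (shiftedMatrix X e e y ω).adjugate.trace ∂P =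
      ∑ i, ∑ k, ∫ ω, (shiftedMatrix X e e x ω).adjugate i i *
        (shiftedMatrix X e e y ω).adjugate k k ∂P := by
    simp only [Matrix.trace, Matrix.diag_apply, Finset.sum_mul_sum]
    rw [integral_finsetSum _ fun i _ => integrable_finsetSum _ fun k _ => hgi i i k k]
    exact Finset.sum_congr rfl fun i _ => integral_finsetSum _ fun k _ => hgi i i k k
  have ht2 : ∫ ω, ((shiftedMatrix X e e x ω).adjugate *
      (shiftedMatrix X e e y ω).adjugate).trace ∂P =
      ∑ i, ∑ j, ∫ ω, (shiftedMatrix X e e x ω).adjugate i j *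
        (shiftedMatrix X e e y ω).adjugate j i ∂P := by
    simp only [Matrix.trace, Matrix.diag_apply, Matrix.mul_apply]
    rw [integral_finsetSum _ fun i _ => integrable_finsetSum _ fun j _ => hgi i j j i]
    exact Finset.sum_congr rfl fun i _ => integral_finsetSum _ fun j _ => hgi i j j i
  rw [ht1, ht2, Finset.mul_sum]
  exact sum_pairing_mul _ _

end IsWignerArray

/-! ### Exact correlation function and mean of the characteristic polynomial -/

theorem continuous_detCorr (γ : ℝ) (n : ℕ) (y : ℝ) : Continuous fun x => detCorr γ n x y :=
  continuous_iff_continuousAt.2 fun x => (hasDerivAt_detCorr γ n x y).continuousAt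

/-- Cofactors on the diagonal are characteristic polynomials of smaller Wigner matrices. -/
theorem adjugate_shiftedMatrix_self {Ω : Type*} (X : ℕ → ℕ → Ω → ℂ) {n : ℕ}
    {e : Fin (n + 1) → ℕ} (x : ℝ) (ω : Ω) (i : Fin (n + 1)) :
    (shiftedMatrix X e e x ω).adjugate i i =
      (shiftedMatrix X (e ∘ i.succAbove) (e ∘ i.succAbove) x ω).det := by
  rw [adjugate_shiftedMatrix, Even.neg_one_pow ⟨_, rfl⟩, one_mul]

namespace IsWignerArray

variable {Ω : Type*} [mΩ : MeasurableSpace Ω] {P : Measure Ω} [IsProbabilityMeasure P]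
  {Q : Measure ℝ} {X : ℕ → ℕ → Ω → ℂ} {n : ℕ} {e : Fin n → ℕ}

theorem hasDerivAt_integral_det_mul_det (hX : IsWignerArray Q P X) (hQ : WignerMoments Q)
    (he : Function.Injective e) (x y : ℝ) :
    HasDerivAt (fun x => ∫ ω, (shiftedMatrix X e e x ω).det * (shiftedMatrix X e e y ω).det ∂P)
      (-∫ ω, (shiftedMatrix X e e x ω).adjugate.trace * (shiftedMatrix X e e y ω).det ∂P) x := by
  obtain ⟨M, hM⟩ : ∃ M, ∀ i, e i < M := ⟨Finset.univ.sup e + 1, fun i =>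
    Nat.lt_succ_of_le (Finset.le_sup (Finset.mem_univ i))⟩
  have h := hX.hasDerivAt_integral_det_mul hQ he hM (hX.measurable_det e y) (D := n.factorial)
    |y| (fun R hR ω => hX.norm_det_shiftedMatrix_le he hM hM hR ω) x
  simpa only [neg_mul, integral_neg] using h

theorem hasDerivAt_integral_det_mul_trace (hX : IsWignerArray Q P X) (hQ : WignerMoments Q)
    (he : Function.Injective e) (x y : ℝ) :
    HasDerivAt (fun x => ∫ ω, (shiftedMatrix X e e x ω).det *
        (shiftedMatrix X e e y ω).adjugate.trace ∂P)
      (-∫ ω, (shiftedMatrix X e e x ω).adjugate.trace *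
        (shiftedMatrix X e e y ω).adjugate.trace ∂P) x := by
  obtain ⟨M, hM⟩ : ∃ M, ∀ i, e i < M := ⟨Finset.univ.sup e + 1, fun i =>
    Nat.lt_succ_of_le (Finset.le_sup (Finset.mem_univ i))⟩
  have h := hX.hasDerivAt_integral_det_mul hQ he hM (hX.measurable_trace_adjugate e y)
    (D := n * n.factorial) |y|
    (fun R hR ω => hX.norm_trace_adjugate_shiftedMatrix_le he hM hM hR ω) x
  simpa only [neg_mul, integral_neg] using h

theorem hasDerivAt_integral_det (hX : IsWignerArray Q P X) (hQ : WignerMoments Q)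
    (he : Function.Injective e) (x : ℝ) :
    HasDerivAt (fun x => ∫ ω, (shiftedMatrix X e e x ω).det ∂P)
      (-∫ ω, (shiftedMatrix X e e x ω).adjugate.trace ∂P) x := by
  obtain ⟨M, hM⟩ : ∃ M, ∀ i, e i < M := ⟨Finset.univ.sup e + 1, fun i =>
    Nat.lt_succ_of_le (Finset.le_sup (Finset.mem_univ i))⟩
  have h := hX.hasDerivAt_integral_det_mul hQ he hM (measurable_const (a := (1 : ℂ)))
    (D := 1) 0 (fun R _ ω => by simpa using one_le_minorEnvelope X R M ω) x
  simpa only [mul_one, integral_neg] using h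

/-- The induction step. Differentiating the hypothesis `ih` evaluates the means containing traces of
single adjugates, the resolvent identity handles the trace of the product, and `ih'` the cumulant
term. What remains is exactly `detCorr_succ`. -/
theorem sub_mul_integral_det_succ (hX : IsWignerArray Q P X) (hQ : WignerMoments Q)
    {e : Fin (n + 1) → ℕ} (he : Function.Injective e) (x y : ℝ) {e' : Fin n → ℕ}
    (he' : e' = e ∘ Fin.succ)
    (ih : ∀ x y : ℝ, ∫ ω, (shiftedMatrix X e' e' x ω).det * (shiftedMatrix X e' e' y ω).det ∂P =
      (detCorr (excess Q) n x y : ℝ))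
    (ih' : ∀ i, ∫ ω, (shiftedMatrix X e' e' x ω).adjugate i i *
      (shiftedMatrix X e' e' y ω).adjugate i i ∂P = (detCorr (excess Q) (n - 1) x y : ℝ)) :
    (x - y : ℂ) * ∫ ω, (shiftedMatrix X e e x ω).det * (shiftedMatrix X e e y ω).det ∂P =
      (x - y : ℂ) * (detCorr (excess Q) (n + 1) x y : ℝ) := by
  have hinj : Function.Injective e' := he' ▸ he.comp (Fin.succ_injective n)
  have hr : ∀ i, e' i ≠ e 0 := fun i h => by
    rw [he'] at h
    exact Fin.succ_ne_zero i (he h)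
  have hfst : ∀ x y : ℝ, ∫ ω, (shiftedMatrix X e' e' x ω).adjugate.trace *
      (shiftedMatrix X e' e' y ω).det ∂P = -(detCorrFst (excess Q) n x y : ℝ) := fun x y => by
    have h1 := hX.hasDerivAt_integral_det_mul_det hQ hinj x y
    simp only [ih] at h1
    rw [← h1.unique (hasDerivAt_detCorr (excess Q) n x y).ofReal_comp, neg_neg]
  have hsnd : ∀ x y : ℝ, ∫ ω, (shiftedMatrix X e' e' x ω).det *
      (shiftedMatrix X e' e' y ω).adjugate.trace ∂P = -(detCorrFst (excess Q) n y x : ℝ) :=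
    fun x y => by simp only [mul_comm (Matrix.det _), hfst]
  have hmix : ∫ ω, (shiftedMatrix X e' e' x ω).adjugate.trace *
      (shiftedMatrix X e' e' y ω).adjugate.trace ∂P = (detCorrMixed (excess Q) n x y : ℝ) := by
    -- The roles of `x` and `y` are exchanged, so that `detCorrFst` is differentiated in its second
    -- variable.
    have h1 := hX.hasDerivAt_integral_det_mul_trace hQ hinj y x
    simp only [hsnd] at h1
    have h2 := h1.unique (hasDerivAt_detCorrFst (excess Q) n x y).ofReal_comp.neg
    simp only [mul_comm (Matrix.trace (shiftedMatrix X e' e' x _).adjugate)]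
    exact neg_injective h2
  have htr : (x - y : ℂ) * ∫ ω, ((shiftedMatrix X e' e' x ω).adjugate *
      (shiftedMatrix X e' e' y ω).adjugate).trace ∂P =
      -(detCorrFst (excess Q) n x y : ℝ) + (detCorrFst (excess Q) n y x : ℝ) := by
    rw [← integral_const_mul]
    simp only [shiftedMatrix_self X hinj, Matrix.sub_mul_trace_adjugate_mul_adjugate]
    simp only [← shiftedMatrix_self X hinj]
    rw [integral_sub, hfst, hsnd, sub_neg_eq_add]
    · simp only [Matrix.trace, Matrix.diag_apply, Finset.sum_mul]
      refine integrable_finsetSum _ fun i _ => ?_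
      simpa only [mul_comm] using hX.integrable_det_mul_adjugate hQ hinj y x i i
    · simp only [Matrix.trace, Matrix.diag_apply, Finset.mul_sum]
      exact integrable_finsetSum _ fun i _ => hX.integrable_det_mul_adjugate hQ hinj x y i i
  obtain ⟨i1, h1⟩ := hX.hasIntegral_diag_det hQ hinj hr x y
  obtain ⟨i2, h2⟩ := hX.hasIntegral_diag_rowForm hQ hinj hr x y
  obtain ⟨i3, h3⟩ := hX.hasIntegral_diag_rowForm hQ hinj hr y x
  obtain ⟨i4, h4⟩ := hX.hasIntegral_rowForm_mul_rowForm hQ hinj hr x y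
  have hexp : ∫ ω, (shiftedMatrix X e e x ω).det * (shiftedMatrix X e e y ω).det ∂P =
      ∫ ω, (X (e 0) (e 0) ω - x) * (shiftedMatrix X e' e' x ω).det *
        ((X (e 0) (e 0) ω - y) * (shiftedMatrix X e' e' y ω).det) ∂P -
      ∫ ω, (X (e 0) (e 0) ω - x) * (shiftedMatrix X e' e' x ω).det * rowForm X e' (e 0) y ω ∂P -
      ∫ ω, (X (e 0) (e 0) ω - y) * (shiftedMatrix X e' e' y ω).det * rowForm X e' (e 0) x ω ∂P +
      ∫ ω, rowForm X e' (e 0) x ω * rowForm X e' (e 0) y ω ∂P := by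
    have hlin := integral_add' ((i1.sub i2).sub i3) i4
    rw [integral_sub' (i1.sub i2) i3, integral_sub' i1 i2] at hlin
    refine Eq.trans (integral_congr_ae (ae_of_all _ fun ω => ?_)) hlin
    simp only [Pi.add_apply, Pi.sub_apply]
    rw [det_shiftedMatrix_succ X he, det_shiftedMatrix_succ X he, ← he']
    ring
  rw [hexp, h1, h2, h3, h4, ih, hsnd, hsnd, hmix]
  simp only [ih', Finset.sum_const, Finset.card_univ, Fintype.card_fin, nsmul_eq_mul]
  have h5 := congrArg (fun t : ℝ => (t : ℂ)) (detCorr_succ (excess Q) n x y)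
  push_cast at h5
  linear_combination htr - h5

/-- The second-order correlation function of the characteristic polynomial. -/
theorem integral_det_mul_det (hX : IsWignerArray Q P X) (hQ : WignerMoments Q) (n : ℕ) :
    ∀ {e : Fin n → ℕ}, Function.Injective e → ∀ x y : ℝ,
      ∫ ω, (shiftedMatrix X e e x ω).det * (shiftedMatrix X e e y ω).det ∂P =
        (detCorr (excess Q) n x y : ℝ) := by
  induction n using Nat.strong_induction_on with
  | _ n ih =>
    intro e he x y
    rcases n with _ | n
    · simp [detCorr, hermiteKernel, hermiteFun_zero]
    have hinj : Function.Injective (e ∘ Fin.succ) := he.comp (Fin.succ_injective n)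
    have hmul := fun x => hX.sub_mul_integral_det_succ hQ he x y rfl (ih n n.lt_succ_self hinj)
      -- A diagonal cofactor of the minor has one size less again, hence the strong induction.
      (fun i => by
        rcases n with _ | n
        · exact i.elim0
        · simp only [adjugate_shiftedMatrix_self]
          exact ih n (by omega) (hinj.comp Fin.succAbove_right_injective) x y)
    -- The factor `x - y` can be cancelled only for `x ≠ y`; continuity and density cover the
    -- diagonal.
    have hc1 : Continuous fun x : ℝ => ∫ ω, (shiftedMatrix X e e x ω).det *
        (shiftedMatrix X e e y ω).det ∂P := continuous_iff_continuousAt.2 fun x =>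
      (hX.hasDerivAt_integral_det_mul_det hQ he x y).continuousAt
    have hc2 : Continuous fun x : ℝ => ((detCorr (excess Q) (n + 1) x y : ℝ) : ℂ) :=
      Complex.continuous_ofReal.comp (continuous_detCorr _ _ _)
    refine congrFun (hc1.ext_on (dense_compl_singleton y) hc2 fun x hx => ?_) x
    refine mul_left_cancel₀ ?_ (hmul x)
    rw [sub_ne_zero]
    exact fun h => hx (Complex.ofReal_injective h)

/-- Averaging the Laplace expansion of one determinant gives `-x` times the mean for the minor plus
the derivative of that mean, which is the Hermite recurrence up to sign. -/
theorem integral_det (hX : IsWignerArray Q P X) (hQ : WignerMoments Q) (n : ℕ) :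
    ∀ {e : Fin n → ℕ}, Function.Injective e → ∀ x : ℝ,
      ∫ ω, (shiftedMatrix X e e x ω).det ∂P = ((-1) ^ n * hermiteFun n x : ℝ) := by
  induction n with
  | zero => intro e he x; simp [hermiteFun_zero]
  | succ n ih =>
    intro e he x
    have hinj : Function.Injective (e ∘ Fin.succ) := he.comp (Fin.succ_injective n)
    have hr : ∀ i, (e ∘ Fin.succ) i ≠ e 0 := fun i h => Fin.succ_ne_zero i (he h)
    simp only [det_shiftedMatrix_succ X he]
    generalize e ∘ Fin.succ = e' at hinj hr
    have htr : ∫ ω, (shiftedMatrix X e' e' x ω).adjugate.trace ∂P =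
        -((-1) ^ n * (n * hermiteFun (n - 1) x) : ℝ) := by
      have h1 := hX.hasDerivAt_integral_det hQ hinj x
      simp only [ih hinj] at h1
      rw [← h1.unique ((hasDerivAt_hermiteFun n x).const_mul _).ofReal_comp, neg_neg]
    have hd : Integrable (fun ω => X (e 0) (e 0) ω - x) P :=
      ((hX.memLp_entry hQ _ _).integrable (by norm_num)).sub (integrable_const _)
    have hdm : Measurable[edgeAlgebra X {z | e 0 ∈ z}] fun ω => X (e 0) (e 0) ω - x :=
      (hX.measurable_row _).sub_const _
    have hm : ∀ i j, Measurable[edgeAlgebra X {z | e 0 ∈ z}]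
        fun ω => X (e 0) (e' i) ω * X (e' j) (e 0) ω := fun i j =>
      (hX.measurable_row _).mul (hX.measurable_column _)
    have hg := hX.measurable_adjugate_off hr x
    have hi : ∀ i j, Integrable (fun ω => X (e 0) (e' i) ω * X (e' j) (e 0) ω *
        (shiftedMatrix X e' e' x ω).adjugate i j) P := fun i j => by
      refine hX.integrable_row_mul_off (hm i j) (hg i j) ?_ (hX.integrable_adjugate hQ hinj x i j)
      simpa using integrable_mul_four (hX.memLp_entry hQ (e 0) (e' i))
        (hX.memLp_entry hQ (e' j) (e 0)) (memLp_const (1 : ℂ)) (memLp_const (1 : ℂ))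
    have hform : ∫ ω, rowForm X e' (e 0) x ω ∂P =
        ∫ ω, (shiftedMatrix X e' e' x ω).adjugate.trace ∂P := by
      simp only [rowForm, Matrix.trace, Matrix.diag_apply]
      rw [integral_finsetSum _ fun i _ => integrable_finsetSum _ fun j _ => hi i j,
        integral_finsetSum _ fun i _ => hX.integrable_adjugate hQ hinj x i i]
      refine Finset.sum_congr rfl fun i _ => ?_
      rw [integral_finsetSum _ fun j _ => hi i j, Finset.sum_eq_single i]
      · rw [hX.integral_row_mul_off (hm i i) (hg i i), hX.integral_row_mul_row hQ hinj hr,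
          if_pos rfl, one_mul]
      · intro j _ hj
        rw [hX.integral_row_mul_off (hm i j) (hg i j), hX.integral_row_mul_row hQ hinj hr,
          if_neg hj.symm, zero_mul]
      · simp
    have hformi : Integrable (rowForm X e' (e 0) x) P :=
      integrable_finsetSum _ fun i _ => integrable_finsetSum _ fun j _ => hi i j
    rw [integral_sub (hX.integrable_row_mul_off hdm (hX.measurable_det_off hr x) hd
      (hX.integrable_det hQ hinj x)) hformi, hform, htr,
      hX.integral_row_mul_off hdm (hX.measurable_det_off hr x), ih hinj,
      integral_sub ((hX.memLp_entry hQ _ _).integrable (by norm_num)) (integrable_const _),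
      hX.integral_entry hQ, hermiteFun_succ]
    simp only [integral_const, probReal_univ, one_smul, zero_sub]
    push_cast
    ring

theorem memLp_det (hX : IsWignerArray Q P X) (hQ : WignerMoments Q)
    (he : Function.Injective e) (x : ℝ) :
    MemLp (fun ω => (shiftedMatrix X e e x ω).det) 2 P := by
  obtain ⟨M, hM⟩ : ∃ M, ∀ i, e i < M := ⟨Finset.univ.sup e + 1, fun i =>
    Nat.lt_succ_of_le (Finset.le_sup (Finset.mem_univ i))⟩
  refine (memLp_two_iff_integrable_sq_norm (hX.measurable_det e x).aestronglyMeasurable).2 ?_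
  simpa only [norm_mul, sq] using (hX.integrable_det_mul_det hQ he x x).norm

end IsWignerArray

/-! ### Hermite functions in the bulk as a rotating wave -/

/-- The point `√N ξ + t / √N`. -/
noncomputable def bulkPoint (ξ : ℝ) (N : ℕ) (t : ℝ) : ℝ := √(N : ℝ) * ξ + t / √(N : ℝ)

/-- The local frequency of the Hermite functions in the bulk. -/
noncomputable def bulkFreq (ξ : ℝ) : ℝ := √(4 - ξ ^ 2) / 2

/-- The unit complex number with real part `ξ / 2` and imaginary part `bulkFreq ξ`. -/
noncomputable def bulkPhase (ξ : ℝ) : ℂ := (ξ / 2 : ℝ) + (bulkFreq ξ : ℝ) * Complex.I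

/-- The Hermite function of index `N`, up to normalization. -/
noncomputable def hermiteWave (N : ℕ) (x : ℝ) : ℝ := Real.exp (-x ^ 2 / 4) * hermiteFun N x

/-- The Hermite function of index `N - 1` in the normalization of `hermiteWave N`. -/
noncomputable def hermiteWavePred (N : ℕ) (x : ℝ) : ℝ :=
  Real.exp (-x ^ 2 / 4) * (√(N : ℝ) * hermiteFun (N - 1) x)

/-- A combination of two consecutive Hermite functions that rotates with frequency `bulkFreq ξ`
in the local variable. -/
noncomputable def bulkWave (ξ : ℝ) (N : ℕ) (t : ℝ) : ℂ :=
  hermiteWave N (bulkPoint ξ N t) - bulkPhase ξ * hermiteWavePred N (bulkPoint ξ N t)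

@[simp] theorem bulkPhase_re (ξ : ℝ) : (bulkPhase ξ).re = ξ / 2 := by
  simp only [bulkPhase, Complex.add_re, Complex.ofReal_re, Complex.re_ofReal_mul, Complex.I_re]
  ring

@[simp] theorem bulkPhase_im (ξ : ℝ) : (bulkPhase ξ).im = bulkFreq ξ := by
  simp only [bulkPhase, Complex.add_im, Complex.ofReal_im, Complex.im_ofReal_mul, Complex.I_im]
  ring

theorem bulkFreq_pos {ξ : ℝ} (hξ : ξ ∈ Set.Ioo (-2 : ℝ) 2) : 0 < bulkFreq ξ := by
  have : 0 < 4 - ξ ^ 2 := by nlinarith [hξ.1, hξ.2]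
  have := Real.sqrt_pos.2 this
  rw [bulkFreq]
  positivity

theorem bulkFreq_sq {ξ : ℝ} (hξ : ξ ∈ Set.Ioo (-2 : ℝ) 2) : bulkFreq ξ ^ 2 = 1 - ξ ^ 2 / 4 := by
  rw [bulkFreq, div_pow, Real.sq_sqrt (by nlinarith [hξ.1, hξ.2])]
  ring

theorem hasDerivAt_exp_neg_sq_div (x : ℝ) :
    HasDerivAt (fun x : ℝ => Real.exp (-x ^ 2 / 4)) (Real.exp (-x ^ 2 / 4) * (-x / 2)) x := by
  refine (((hasDerivAt_pow 2 x).neg.div_const 4).exp).congr_deriv ?_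
  simp
  ring

theorem hasDerivAt_hermiteWave (N : ℕ) (x : ℝ) :
    HasDerivAt (hermiteWave N)
      (-x / 2 * hermiteWave N x + √(N : ℝ) * hermiteWavePred N x) x := by
  refine ((hasDerivAt_exp_neg_sq_div x).mul (hasDerivAt_hermiteFun N x)).congr_deriv ?_
  have h : √(N : ℝ) * √(N : ℝ) = N := Real.mul_self_sqrt N.cast_nonneg
  rw [hermiteWave, hermiteWavePred]
  linear_combination -(Real.exp (-x ^ 2 / 4) * hermiteFun (N - 1) x) * h

theorem hasDerivAt_hermiteWavePred {N : ℕ} (hN : 0 < N) (x : ℝ) :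
    HasDerivAt (hermiteWavePred N)
      (x / 2 * hermiteWavePred N x - √(N : ℝ) * hermiteWave N x) x := by
  refine ((hasDerivAt_exp_neg_sq_div x).mul
    ((hasDerivAt_hermiteFun (N - 1) x).const_mul √(N : ℝ))).congr_deriv ?_
  have h := hermiteFun_succ (N - 1) x
  rw [Nat.sub_add_cancel hN] at h
  rw [hermiteWave, hermiteWavePred, h]
  ring

theorem hasDerivAt_bulkPoint (ξ : ℝ) (N : ℕ) (t : ℝ) :
    HasDerivAt (bulkPoint ξ N) (1 / √(N : ℝ)) t :=
  ((hasDerivAt_id t).div_const √(N : ℝ)).const_add _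

theorem bulkPoint_div {N : ℕ} (hN : 0 < N) (ξ t : ℝ) :
    bulkPoint ξ N t / √(N : ℝ) = ξ + t / N := by
  have h : √(N : ℝ) ≠ 0 := (Real.sqrt_pos.2 (Nat.cast_pos.2 hN)).ne'
  rw [bulkPoint, add_div, mul_div_cancel_left₀ _ h, div_div, Real.mul_self_sqrt N.cast_nonneg]

/-- With `x / √N = ξ + t / N`, the system for the two waves `u`, `v` is `u' = -(ξ/2) u + v`, `v' =
(ξ/2) v - u` up to terms in `t / (2N)`. Its eigenvalues are `±i bulkFreq ξ`, and `bulkPhase ξ` is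
chosen to make `u - bulkPhase ξ * v` the eigencombination for `+i`. -/
theorem hasDerivAt_bulkWave {ξ : ℝ} (hξ : ξ ∈ Set.Ioo (-2 : ℝ) 2) {N : ℕ} (hN : 0 < N) (t : ℝ) :
    HasDerivAt (bulkWave ξ N) ((bulkFreq ξ : ℂ) * Complex.I * bulkWave ξ N t -
      ((t / (2 * N) : ℝ) : ℂ) * (hermiteWave N (bulkPoint ξ N t) +
        bulkPhase ξ * hermiteWavePred N (bulkPoint ξ N t))) t := by
  have h1 := ((hasDerivAt_hermiteWave N (bulkPoint ξ N t)).comp t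
    (hasDerivAt_bulkPoint ξ N t)).ofReal_comp
  have h2 := ((hasDerivAt_hermiteWavePred hN (bulkPoint ξ N t)).comp t
    (hasDerivAt_bulkPoint ξ N t)).ofReal_comp
  refine (h1.sub (h2.const_mul (bulkPhase ξ))).congr_deriv ?_
  have h0 : √(N : ℝ) ≠ 0 := (Real.sqrt_pos.2 (Nat.cast_pos.2 hN)).ne'
  have h3 := bulkPoint_div hN ξ t
  have h4 : √(N : ℝ) * (1 / √(N : ℝ)) = 1 := mul_one_div_cancel h0
  rw [bulkWave]
  generalize hermiteWave N (bulkPoint ξ N t) = u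
  generalize hermiteWavePred N (bulkPoint ξ N t) = v
  have e1 : (-bulkPoint ξ N t / 2 * u + √(N : ℝ) * v) * (1 / √(N : ℝ)) =
      -(ξ / 2 + t / (2 * N)) * u + v := by
    linear_combination (-u / 2) * h3 + v * h4
  have e2 : (bulkPoint ξ N t / 2 * v - √(N : ℝ) * u) * (1 / √(N : ℝ)) =
      (ξ / 2 + t / (2 * N)) * v - u := by
    linear_combination (v / 2) * h3 - u * h4
  rw [e1, e2, bulkPhase]
  have hsq : (bulkFreq ξ : ℂ) ^ 2 = 1 - ξ ^ 2 / 4 := by exact_mod_cast bulkFreq_sq hξ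
  push_cast
  linear_combination (-v : ℂ) * hsq + v * (bulkFreq ξ : ℂ) ^ 2 * Complex.I_sq

theorem norm_sq_sub_bulkPhase_mul {ξ : ℝ} (hξ : ξ ∈ Set.Ioo (-2 : ℝ) 2) (u v : ℝ) :
    ‖(u : ℂ) - bulkPhase ξ * v‖ ^ 2 = u ^ 2 + v ^ 2 - ξ * u * v := by
  rw [← Complex.normSq_eq_norm_sq, Complex.normSq_apply]
  simp
  linear_combination v ^ 2 * bulkFreq_sq hξ

theorem norm_sq_add_bulkPhase_mul {ξ : ℝ} (hξ : ξ ∈ Set.Ioo (-2 : ℝ) 2) (u v : ℝ) :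
    ‖(u : ℂ) + bulkPhase ξ * v‖ ^ 2 = u ^ 2 + v ^ 2 + ξ * u * v := by
  have h := norm_sq_sub_bulkPhase_mul hξ u (-v)
  push_cast at h
  rw [mul_neg, sub_neg_eq_add] at h
  rw [h]
  ring

/-- The antisymmetric form in the Christoffel–Darboux numerator; the squared norm above is the form
of its confluent version at `t = 0`. -/
theorem im_sub_bulkPhase_mul_conj (ξ u v u' v' : ℝ) :
    (((u : ℂ) - bulkPhase ξ * v) * (starRingEnd ℂ) ((u' : ℂ) - bulkPhase ξ * v')).im =
      bulkFreq ξ * (u * v' - v * u') := by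
  simp
  ring

theorem abs_mul_le_norm_sq {ξ : ℝ} (hξ : ξ ∈ Set.Ioo (-2 : ℝ) 2) (u v : ℝ) :
    (2 - |ξ|) * |u * v| ≤ ‖(u : ℂ) - bulkPhase ξ * v‖ ^ 2 := by
  rw [norm_sq_sub_bulkPhase_mul hξ]
  have h1 : ξ * u * v ≤ |ξ| * |u * v| := by
    rw [mul_assoc, ← abs_mul]
    exact le_abs_self _
  have h2 : 2 * |u * v| ≤ u ^ 2 + v ^ 2 := by
    rw [abs_mul, ← sq_abs u, ← sq_abs v]
    nlinarith [sq_nonneg (|u| - |v|)]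
  linarith

/-- The squared norms differ by `2 ξ u v`, which `abs_mul_le_norm_sq` controls since `|ξ| < 2`. The
constant is at least `1`, hence at most its square, so it also serves for the norms. This bounds the
error term of `hasDerivAt_bulkWave` by the wave itself. -/
theorem norm_add_bulkPhase_mul_le {ξ : ℝ} (hξ : ξ ∈ Set.Ioo (-2 : ℝ) 2) (u v : ℝ) :
    ‖(u : ℂ) + bulkPhase ξ * v‖ ≤
      (1 + 4 / (2 - |ξ|)) * ‖(u : ℂ) - bulkPhase ξ * v‖ := by
  have hξ' : 0 < 2 - |ξ| := by
    have := abs_lt.2 hξ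
    linarith
  have h := abs_mul_le_norm_sq hξ u v
  have h1 : |u * v| ≤ ‖(u : ℂ) - bulkPhase ξ * v‖ ^ 2 / (2 - |ξ|) := by
    rw [le_div_iff₀ hξ']
    linarith
  have h2 : ‖(u : ℂ) + bulkPhase ξ * v‖ ^ 2 ≤
      (1 + 4 / (2 - |ξ|)) * ‖(u : ℂ) - bulkPhase ξ * v‖ ^ 2 := by
    have e : ‖(u : ℂ) + bulkPhase ξ * v‖ ^ 2 =
        ‖(u : ℂ) - bulkPhase ξ * v‖ ^ 2 + 2 * (ξ * (u * v)) := by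
      rw [norm_sq_add_bulkPhase_mul hξ, norm_sq_sub_bulkPhase_mul hξ]
      ring
    have h3 : ξ * (u * v) ≤ 2 * |u * v| := by
      refine (le_abs_self _).trans ?_
      rw [abs_mul]
      have := abs_nonneg (u * v)
      gcongr
      linarith
    rw [e]
    have : (1 + 4 / (2 - |ξ|)) * ‖(u : ℂ) - bulkPhase ξ * v‖ ^ 2 =
      ‖(u : ℂ) - bulkPhase ξ * v‖ ^ 2 + 4 * (‖(u : ℂ) - bulkPhase ξ * v‖ ^ 2 / (2 - |ξ|)) := by
      ring
    rw [this]
    linarith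
  have h4 : 1 ≤ 1 + 4 / (2 - |ξ|) := by
    have : 0 < 4 / (2 - |ξ|) := by positivity
    linarith
  refine abs_le_of_sq_le_sq' ?_ (by positivity) |>.2
  rw [mul_pow]
  refine h2.trans (mul_le_mul_of_nonneg_right ?_ (sq_nonneg _))
  nlinarith

/-- `bulkWave ξ N` in the rotating frame. -/
noncomputable def bulkAmplitude (ξ : ℝ) (N : ℕ) (t : ℝ) : ℂ :=
  Complex.exp (-((bulkFreq ξ * t : ℝ) * Complex.I)) * bulkWave ξ N t

theorem norm_bulkAmplitude (ξ : ℝ) (N : ℕ) (t : ℝ) :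
    ‖bulkAmplitude ξ N t‖ = ‖bulkWave ξ N t‖ := by
  rw [bulkAmplitude, norm_mul, ← neg_mul, ← Complex.ofReal_neg, Complex.norm_exp_ofReal_mul_I,
    one_mul]

theorem bulkWave_eq (ξ : ℝ) (N : ℕ) (t : ℝ) : bulkWave ξ N t =
    Complex.exp ((bulkFreq ξ * t : ℝ) * Complex.I) * bulkAmplitude ξ N t := by
  rw [bulkAmplitude, ← mul_assoc, ← Complex.exp_add, add_neg_cancel, Complex.exp_zero, one_mul]

theorem hasDerivAt_bulkAmplitude {ξ : ℝ} (hξ : ξ ∈ Set.Ioo (-2 : ℝ) 2) {N : ℕ} (hN : 0 < N)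
    (t : ℝ) : HasDerivAt (bulkAmplitude ξ N) (-(((t / (2 * N) : ℝ) : ℂ) *
      Complex.exp (-((bulkFreq ξ * t : ℝ) * Complex.I)) * (hermiteWave N (bulkPoint ξ N t) +
        bulkPhase ξ * hermiteWavePred N (bulkPoint ξ N t)))) t := by
  have h1 : HasDerivAt (fun t : ℝ => Complex.exp (-((bulkFreq ξ * t : ℝ) * Complex.I)))
      (Complex.exp (-((bulkFreq ξ * t : ℝ) * Complex.I)) * -((bulkFreq ξ : ℝ) * Complex.I)) t := by
    have := ((hasDerivAt_id t).const_mul (bulkFreq ξ)).ofReal_comp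
    simpa using ((this.mul_const Complex.I).neg).cexp
  refine (h1.mul (hasDerivAt_bulkWave hξ hN t)).congr_deriv ?_
  ring

/-- Gronwall's inequality for the increment from `s`, which starts at zero. The bound is relative to
the amplitude at `s`, so the absolute size of the wave never has to be known. -/
theorem norm_bulkAmplitude_sub_le {ξ : ℝ} (hξ : ξ ∈ Set.Ioo (-2 : ℝ) 2) {N : ℕ} (hN : 0 < N)
    {s t T : ℝ} (hT : 0 < T) (hs : |s| ≤ T) (ht : |t| ≤ T) (hst : s ≤ t) :
    ‖bulkAmplitude ξ N t - bulkAmplitude ξ N s‖ ≤ ‖bulkAmplitude ξ N s‖ *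
      (Real.exp (T * (1 + 4 / (2 - |ξ|)) / (2 * N) * (t - s)) - 1) := by
  have hξ' : 0 < 2 - |ξ| := by
    have := abs_lt.2 hξ
    linarith
  have hN' : (0 : ℝ) < N := Nat.cast_pos.2 hN
  set κ : ℝ := T * (1 + 4 / (2 - |ξ|)) / (2 * N) with hκ
  have hκ0 : 0 < κ := by positivity
  have h := norm_le_gronwallBound_of_norm_deriv_right_le
    (f := fun τ => bulkAmplitude ξ N τ - bulkAmplitude ξ N s) (δ := 0) (K := κ)
    (ε := κ * ‖bulkAmplitude ξ N s‖) (a := s) (b := t)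
    (fun τ _ => ((hasDerivAt_bulkAmplitude hξ hN τ).sub_const _).continuousAt.continuousWithinAt)
    (fun τ _ => ((hasDerivAt_bulkAmplitude hξ hN τ).sub_const _).hasDerivWithinAt)
    (by simp) (fun τ hτ => ?_) t ⟨hst, le_rfl⟩
  · simpa only [gronwallBound_of_K_ne_0 hκ0.ne', zero_mul, zero_add,
      mul_div_cancel_left₀ _ hκ0.ne'] using h
  · have hτT : |τ| ≤ T := abs_le.2 ⟨(abs_le.1 hs).1.trans hτ.1, hτ.2.le.trans (abs_le.1 ht).2⟩
    have h1 := norm_add_bulkPhase_mul_le hξ (hermiteWave N (bulkPoint ξ N τ))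
      (hermiteWavePred N (bulkPoint ξ N τ))
    change _ ≤ _ * ‖bulkWave ξ N τ‖ at h1
    rw [← norm_bulkAmplitude] at h1
    have h2 : ‖bulkAmplitude ξ N τ‖ ≤ ‖bulkAmplitude ξ N τ - bulkAmplitude ξ N s‖ +
        ‖bulkAmplitude ξ N s‖ := by
      simpa using norm_add_le (bulkAmplitude ξ N τ - bulkAmplitude ξ N s) (bulkAmplitude ξ N s)
    rw [norm_neg, norm_mul, norm_mul, ← neg_mul, ← Complex.ofReal_neg,
      Complex.norm_exp_ofReal_mul_I, mul_one, Complex.norm_real, Real.norm_eq_abs, abs_div,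
      abs_of_pos (show (0 : ℝ) < 2 * N by positivity)]
    calc |τ| / (2 * N) * _ ≤ T / (2 * N) * ((1 + 4 / (2 - |ξ|)) * ‖bulkAmplitude ξ N τ‖) := by
          gcongr
      _ = κ * ‖bulkAmplitude ξ N τ‖ := by rw [hκ]; ring
      _ ≤ κ * (‖bulkAmplitude ξ N τ - bulkAmplitude ξ N s‖ + ‖bulkAmplitude ξ N s‖) := by
          gcongr
      _ = _ := by ring

theorem one_le_hermiteKernel_self {N : ℕ} (hN : 0 < N) (x : ℝ) : 1 ≤ hermiteKernel N x x := by
  obtain ⟨n, rfl⟩ : ∃ n, N = n + 1 := ⟨N - 1, by omega⟩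
  rw [hermiteKernel, Finset.sum_range_succ']
  have : 0 ≤ ∑ k ∈ Finset.range n, hermiteFun (k + 1) x * hermiteFun (k + 1) x /
      ((k + 1).factorial : ℝ) :=
    Finset.sum_nonneg fun k _ => div_nonneg (mul_self_nonneg _) (Nat.cast_nonneg _)
  simpa [hermiteFun_zero] using this

/-- In the confluent formula the mixed term carries `x / √N = ξ + t / N`. Its part with `ξ`
completes the squared norm of the wave and the rest is the correction. -/
theorem hermiteKernel_bulkPoint_self {ξ : ℝ} (hξ : ξ ∈ Set.Ioo (-2 : ℝ) 2) {N : ℕ} (hN : 0 < N)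
    (t : ℝ) : hermiteKernel N (bulkPoint ξ N t) (bulkPoint ξ N t) =
      N / N.factorial * Real.exp (bulkPoint ξ N t ^ 2 / 4) ^ 2 * (‖bulkWave ξ N t‖ ^ 2 -
        t / N * (hermiteWave N (bulkPoint ξ N t) * hermiteWavePred N (bulkPoint ξ N t))) := by
  rw [bulkWave, norm_sq_sub_bulkPhase_mul hξ, hermiteKernel_self]
  have h3 := bulkPoint_div hN ξ t
  have h0 : √(N : ℝ) ≠ 0 := (Real.sqrt_pos.2 (Nat.cast_pos.2 hN)).ne'
  have hs : √(N : ℝ) * √(N : ℝ) = N := Real.mul_self_sqrt N.cast_nonneg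
  generalize bulkPoint ξ N t = x at *
  have hx : x = (ξ + t / N) * √(N : ℝ) := (div_eq_iff h0).1 h3
  have he : Real.exp (x ^ 2 / 4) * Real.exp (-x ^ 2 / 4) = 1 := by
    rw [← Real.exp_add, neg_div, add_neg_cancel, Real.exp_zero]
  rw [hermiteWave, hermiteWavePred]
  generalize Real.exp (x ^ 2 / 4) = E at *
  generalize Real.exp (-x ^ 2 / 4) = F at *
  generalize hermiteFun N x = a
  generalize hermiteFun (N - 1) x = b
  have : E ^ 2 * ((F * a) ^ 2 + (F * (√(N : ℝ) * b)) ^ 2 - ξ * (F * a) * (F * (√(N : ℝ) * b)) -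
      t / N * (F * a * (F * (√(N : ℝ) * b)))) = (E * F) ^ 2 *
      (a ^ 2 + √(N : ℝ) * √(N : ℝ) * b ^ 2 - ((ξ + t / N) * √(N : ℝ)) * a * b) := by ring
  rw [mul_assoc (N / N.factorial : ℝ), this, he, hs, ← hx]
  ring

theorem hermiteKernel_bulkPoint {ξ : ℝ} {N : ℕ} (hN : 0 < N)
    (t s : ℝ) : bulkFreq ξ * (t - s) * hermiteKernel N (bulkPoint ξ N t) (bulkPoint ξ N s) =
      N / N.factorial *
        (Real.exp (bulkPoint ξ N t ^ 2 / 4) * Real.exp (bulkPoint ξ N s ^ 2 / 4)) *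
        (bulkWave ξ N t * (starRingEnd ℂ) (bulkWave ξ N s)).im := by
  rw [bulkWave, bulkWave, im_sub_bulkPhase_mul_conj]
  have h0 : √(N : ℝ) ≠ 0 := (Real.sqrt_pos.2 (Nat.cast_pos.2 hN)).ne'
  have hts : t - s = √(N : ℝ) * (bulkPoint ξ N t - bulkPoint ξ N s) := by
    rw [bulkPoint, bulkPoint]
    field_simp
    ring
  have he : ∀ x : ℝ, Real.exp (x ^ 2 / 4) * Real.exp (-x ^ 2 / 4) = 1 := fun x => by
    rw [← Real.exp_add, neg_div, add_neg_cancel, Real.exp_zero]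
  rw [hts]
  generalize bulkPoint ξ N t = x
  generalize bulkPoint ξ N s = y
  have hcd := sub_mul_hermiteKernel N x y
  simp only [hermiteWave, hermiteWavePred]
  have : bulkFreq ξ * (√(N : ℝ) * (x - y)) * hermiteKernel N x y =
    bulkFreq ξ * √(N : ℝ) * ((x - y) * hermiteKernel N x y) := by ring
  rw [this, hcd]
  linear_combination (-(bulkFreq ξ * √(N : ℝ) * (N * (hermiteFun N x * hermiteFun (N - 1) y -
    hermiteFun (N - 1) x * hermiteFun N y) / N.factorial))) *
    (Real.exp (y ^ 2 / 4) * Real.exp (-y ^ 2 / 4) * he x + he y)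

/-- A zero would make the diagonal kernel vanish, but its term of index `0` is already `1`. -/
theorem bulkWave_ne_zero {ξ : ℝ} (hξ : ξ ∈ Set.Ioo (-2 : ℝ) 2) {N : ℕ} (hN : 0 < N)
    (t : ℝ) : bulkWave ξ N t ≠ 0 := by
  intro h
  have h1 := one_le_hermiteKernel_self hN (bulkPoint ξ N t)
  have h2 := abs_mul_le_norm_sq hξ (hermiteWave N (bulkPoint ξ N t))
    (hermiteWavePred N (bulkPoint ξ N t))
  change _ ≤ ‖bulkWave ξ N t‖ ^ 2 at h2
  have hξ' : 0 < 2 - |ξ| := by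
    have := abs_lt.2 hξ
    linarith
  rw [h, norm_zero, zero_pow two_ne_zero] at h2
  have h3 : |hermiteWave N (bulkPoint ξ N t) * hermiteWavePred N (bulkPoint ξ N t)| = 0 :=
    le_antisymm (by by_contra! h4; exact absurd h2 (not_le.2 (mul_pos hξ' h4))) (abs_nonneg _)
  rw [hermiteKernel_bulkPoint_self hξ hN, h, abs_eq_zero.1 h3] at h1
  norm_num at h1

theorem tendsto_bulkAmplitude_div {ξ : ℝ} (hξ : ξ ∈ Set.Ioo (-2 : ℝ) 2) {s t : ℝ} (hst : s ≤ t) :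
    Tendsto (fun N => bulkAmplitude ξ N t / bulkAmplitude ξ N s) atTop (𝓝 1) := by
  set T : ℝ := 1 + |s| + |t| with hT
  have hT0 : 0 < T := by positivity
  have hlim : Tendsto (fun N : ℕ => Real.exp (T * (1 + 4 / (2 - |ξ|)) / (2 * N) * (t - s)) - 1)
      atTop (𝓝 0) := by
    have h1 : Tendsto (fun N : ℕ => T * (1 + 4 / (2 - |ξ|)) / 2 * (t - s) / (N : ℝ)) atTop (𝓝 0) :=
      tendsto_const_div_atTop_nhds_zero_nat _
    have h2 := ((Real.continuous_exp.tendsto 0).comp h1).sub_const 1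
    rw [Real.exp_zero, sub_self] at h2
    refine h2.congr fun N => ?_
    simp only [Function.comp_apply]
    congr 2
    ring
  rw [tendsto_iff_norm_sub_tendsto_zero]
  refine squeeze_zero' (Eventually.of_forall fun _ => norm_nonneg _) ?_ hlim
  filter_upwards [eventually_gt_atTop 0] with N hN
  have h0 : bulkAmplitude ξ N s ≠ 0 := by
    rw [← norm_ne_zero_iff, norm_bulkAmplitude, norm_ne_zero_iff]
    exact bulkWave_ne_zero hξ hN s
  have h := norm_bulkAmplitude_sub_le hξ hN hT0
    (show |s| ≤ T by have := abs_nonneg t; linarith)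
    (show |t| ≤ T by have := abs_nonneg s; linarith) hst
  rw [div_sub_one h0, norm_div, div_le_iff₀ (norm_pos_iff.2 h0), mul_comm]
  exact h

theorem tendsto_bulkWave_div {ξ : ℝ} (hξ : ξ ∈ Set.Ioo (-2 : ℝ) 2) {s t : ℝ} (hst : s ≤ t) :
    Tendsto (fun N => bulkWave ξ N t / bulkWave ξ N s) atTop
      (𝓝 (Complex.exp ((bulkFreq ξ * (t - s) : ℝ) * Complex.I))) := by
  have h := (tendsto_bulkAmplitude_div hξ hst).const_mul
    (Complex.exp ((bulkFreq ξ * (t - s) : ℝ) * Complex.I))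
  rw [mul_one] at h
  refine h.congr fun N => ?_
  rw [bulkWave_eq ξ N t, bulkWave_eq ξ N s, mul_div_mul_comm, ← Complex.exp_sub]
  congr 2
  push_cast
  ring

/-! ### Sine kernel limit of the normalized Christoffel–Darboux kernel -/

/-- The relative size of the diagonal Christoffel–Darboux kernel and the squared amplitude. -/
noncomputable def kernelCorrection (ξ : ℝ) (N : ℕ) (t : ℝ) : ℝ :=
  1 - t / N * (hermiteWave N (bulkPoint ξ N t) * hermiteWavePred N (bulkPoint ξ N t)) /
    ‖bulkWave ξ N t‖ ^ 2

theorem tendsto_kernelCorrection {ξ : ℝ} (hξ : ξ ∈ Set.Ioo (-2 : ℝ) 2) (t : ℝ) :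
    Tendsto (fun N => kernelCorrection ξ N t) atTop (𝓝 1) := by
  have hξ' : 0 < 2 - |ξ| := by
    have := abs_lt.2 hξ
    linarith
  have h : Tendsto (fun N : ℕ => t / N * (hermiteWave N (bulkPoint ξ N t) *
      hermiteWavePred N (bulkPoint ξ N t)) / ‖bulkWave ξ N t‖ ^ 2) atTop (𝓝 0) := by
    refine squeeze_zero_norm' (a := fun N : ℕ => |t| / (2 - |ξ|) / N) ?_
      (tendsto_const_div_atTop_nhds_zero_nat _)
    filter_upwards [eventually_gt_atTop 0] with N hN
    have h0 : 0 < ‖bulkWave ξ N t‖ ^ 2 := by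
      have := norm_pos_iff.2 (bulkWave_ne_zero hξ hN t)
      positivity
    have h2 := abs_mul_le_norm_sq hξ (hermiteWave N (bulkPoint ξ N t))
      (hermiteWavePred N (bulkPoint ξ N t))
    change _ ≤ ‖bulkWave ξ N t‖ ^ 2 at h2
    have hN' : (0 : ℝ) < N := Nat.cast_pos.2 hN
    rw [Real.norm_eq_abs, abs_div, abs_of_pos h0, div_le_iff₀ h0, abs_mul, abs_div,
      abs_of_pos hN', div_div, div_mul_eq_mul_div, div_mul_eq_mul_div, div_le_div_iff₀ hN'
      (by positivity)]
    have := abs_nonneg t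
    calc _ = |t| * N * ((2 - |ξ|) * |hermiteWave N (bulkPoint ξ N t) *
          hermiteWavePred N (bulkPoint ξ N t)|) := by ring
      _ ≤ |t| * N * ‖bulkWave ξ N t‖ ^ 2 := by gcongr
      _ = _ := by ring
  simpa [kernelCorrection] using h.const_sub 1

theorem hermiteKernel_bulkPoint_self_eq {ξ : ℝ} (hξ : ξ ∈ Set.Ioo (-2 : ℝ) 2) {N : ℕ}
    (hN : 0 < N) (t : ℝ) : hermiteKernel N (bulkPoint ξ N t) (bulkPoint ξ N t) =
      N / N.factorial * (Real.exp (bulkPoint ξ N t ^ 2 / 4) * ‖bulkWave ξ N t‖) ^ 2 *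
        kernelCorrection ξ N t := by
  have h0 := (norm_pos_iff.2 (bulkWave_ne_zero hξ hN t)).ne'
  rw [hermiteKernel_bulkPoint_self hξ hN, kernelCorrection]
  field_simp

/-- The Christoffel–Darboux kernel divided by the square roots of its diagonal values. -/
noncomputable def kernelRatio (ξ : ℝ) (M N : ℕ) (t s : ℝ) : ℝ :=
  hermiteKernel M (bulkPoint ξ N t) (bulkPoint ξ N s) /
    (√(hermiteKernel N (bulkPoint ξ N t) (bulkPoint ξ N t)) *
      √(hermiteKernel N (bulkPoint ξ N s) (bulkPoint ξ N s)))

theorem kernelRatio_comm (ξ : ℝ) (M N : ℕ) (t s : ℝ) :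
    kernelRatio ξ M N t s = kernelRatio ξ M N s t := by
  rw [kernelRatio, kernelRatio, hermiteKernel_comm, mul_comm (√_)]

theorem kernelRatio_self {ξ : ℝ} {N : ℕ} (hN : 0 < N) (t : ℝ) : kernelRatio ξ N N t t = 1 := by
  have := one_le_hermiteKernel_self hN (bulkPoint ξ N t)
  rw [kernelRatio, Real.mul_self_sqrt (by linarith), div_self (by linarith)]

/-- Gaussian factors and `N / N!` cancel in the ratio. What remains depends only on the quotient of
the waves at `t` and `s` and on corrections tending to `1`. The order of `s` and `t` comes from
Gronwall; symmetry removes it afterwards. -/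
theorem tendsto_kernelRatio_of_lt {ξ : ℝ} (hξ : ξ ∈ Set.Ioo (-2 : ℝ) 2) {s t : ℝ} (hst : s < t) :
    Tendsto (fun N => kernelRatio ξ N N t s) atTop (𝓝 (Real.sinc (bulkFreq ξ * (t - s)))) := by
  have hω : bulkFreq ξ * (t - s) ≠ 0 := mul_ne_zero (bulkFreq_pos hξ).ne' (sub_ne_zero.2 hst.ne')
  have hw := tendsto_bulkWave_div hξ hst.le
  have h1 := (Complex.continuous_im.tendsto _).comp hw
  have h2 := (continuous_norm.tendsto _).comp hw
  have h3 := (tendsto_kernelCorrection hξ t).sqrt.mul (tendsto_kernelCorrection hξ s).sqrt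
  rw [Complex.norm_exp_ofReal_mul_I] at h2
  rw [Complex.exp_ofReal_mul_I_im] at h1
  have h4 := (h1.div_const (bulkFreq ξ * (t - s))).div (h2.mul h3) (by simp)
  rw [Real.sinc_of_ne_zero hω]
  simp only [Real.sqrt_one, mul_one, div_one] at h4
  refine h4.congr' ?_
  filter_upwards [eventually_gt_atTop 0,
    (tendsto_kernelCorrection hξ t).eventually (lt_mem_nhds one_pos),
    (tendsto_kernelCorrection hξ s).eventually (lt_mem_nhds one_pos)] with N hN ht hs
  have hN' : (0 : ℝ) < N := Nat.cast_pos.2 hN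
  have hZs := bulkWave_ne_zero hξ hN s
  have hZs' := norm_pos_iff.2 hZs
  have hZt' := norm_pos_iff.2 (bulkWave_ne_zero hξ hN t)
  have hA : (0 : ℝ) ≤ N / N.factorial := by positivity
  have hA' : (0 : ℝ) < N / N.factorial := by positivity
  have hsq : ∀ {t : ℝ}, √(hermiteKernel N (bulkPoint ξ N t) (bulkPoint ξ N t)) =
      √(N / N.factorial) * (Real.exp (bulkPoint ξ N t ^ 2 / 4) * ‖bulkWave ξ N t‖) *
        √(kernelCorrection ξ N t) := fun {t} => by
    rw [hermiteKernel_bulkPoint_self_eq hξ hN, Real.sqrt_mul (by positivity),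
      Real.sqrt_mul hA, Real.sqrt_sq (by positivity)]
  have him : (bulkWave ξ N t * (starRingEnd ℂ) (bulkWave ξ N s)).im =
      ‖bulkWave ξ N s‖ ^ 2 * (bulkWave ξ N t / bulkWave ξ N s).im := by
    rw [← Complex.im_ofReal_mul, Complex.ofReal_pow, ← Complex.mul_conj', mul_assoc,
      mul_comm (starRingEnd ℂ _)]
    congr 1
    field_simp
  have hker : hermiteKernel N (bulkPoint ξ N t) (bulkPoint ξ N s) = N / N.factorial *
        (Real.exp (bulkPoint ξ N t ^ 2 / 4) * Real.exp (bulkPoint ξ N s ^ 2 / 4)) *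
        (‖bulkWave ξ N s‖ ^ 2 * (bulkWave ξ N t / bulkWave ξ N s).im) /
        (bulkFreq ξ * (t - s)) := by
    rw [eq_div_iff hω, mul_comm _ (bulkFreq ξ * _), hermiteKernel_bulkPoint hN, him]
  have e := Real.mul_self_sqrt hA
  have ht' := Real.sqrt_pos.2 ht
  have hs' := Real.sqrt_pos.2 hs
  rw [kernelRatio, hker, hsq, hsq]
  simp only [Function.comp_apply, Pi.div_apply, norm_div]
  generalize √(kernelCorrection ξ N t) = rt at *
  generalize √(kernelCorrection ξ N s) = rs at *
  generalize (bulkWave ξ N t / bulkWave ξ N s).im = w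
  generalize bulkFreq ξ * (t - s) = θ at *
  generalize ‖bulkWave ξ N t‖ = zt at *
  generalize ‖bulkWave ξ N s‖ = zs at *
  have het := Real.exp_pos (bulkPoint ξ N t ^ 2 / 4)
  have hes := Real.exp_pos (bulkPoint ξ N s ^ 2 / 4)
  generalize Real.exp (bulkPoint ξ N t ^ 2 / 4) = et at *
  generalize Real.exp (bulkPoint ξ N s ^ 2 / 4) = es at *
  have hB := Real.sqrt_pos.2 hA'
  generalize √((N : ℝ) / N.factorial) = B at *
  rw [← e]
  field_simp

theorem tendsto_kernelRatio {ξ : ℝ} (hξ : ξ ∈ Set.Ioo (-2 : ℝ) 2) (s t : ℝ) :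
    Tendsto (fun N => kernelRatio ξ N N t s) atTop (𝓝 (Real.sinc (bulkFreq ξ * (t - s)))) := by
  rcases lt_trichotomy s t with h | rfl | h
  · exact tendsto_kernelRatio_of_lt hξ h
  · rw [sub_self, mul_zero, Real.sinc_zero]
    refine tendsto_const_nhds.congr' ?_
    filter_upwards [eventually_gt_atTop 0] with N hN
    rw [kernelRatio_self hN]
  · simp only [fun N => kernelRatio_comm ξ N N t s]
    rw [← Real.sinc_neg, ← mul_neg, neg_sub]
    exact tendsto_kernelRatio_of_lt hξ h

/-! ### Stability of the limit under lowering the kernel index -/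

/-- A lower bound for the diagonal Christoffel–Darboux kernel in the oscillatory region. -/
theorem sq_hermiteFun_le (n : ℕ) (x : ℝ) :
    (n + 1 - x ^ 2 / 4) * (hermiteFun n x ^ 2 / n.factorial) ≤ hermiteKernel (n + 1) x x := by
  rw [hermiteKernel_self, Nat.factorial_succ, Nat.add_sub_cancel]
  have hf : (0 : ℝ) < n.factorial := Nat.cast_pos.2 n.factorial_pos
  have hn : (n + 1 : ℝ) ≠ 0 := by positivity
  push_cast
  rw [mul_comm (n + 1 : ℝ) (n.factorial : ℝ), mul_div_mul_right _ _ hn, mul_div_assoc']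
  gcongr
  -- Completing the square in the confluent formula leaves `n + 1 - x² / 4` as the coefficient of
  -- `H_n²`.
  nlinarith [sq_nonneg (hermiteFun (n + 1) x - x / 2 * hermiteFun n x)]

theorem hermiteKernel_mono (x : ℝ) : Monotone fun n => hermiteKernel n x x :=
  monotone_nat_of_le_succ fun n => by
    rw [hermiteKernel_succ]
    have : 0 ≤ hermiteFun n x * hermiteFun n x / n.factorial :=
      div_nonneg (mul_self_nonneg _) (Nat.cast_nonneg _)
    linarith

theorem sq_hermiteKernel_sub_le {M N : ℕ} (h : M ≤ N) (x y : ℝ) :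
    (hermiteKernel N x y - hermiteKernel M x y) ^ 2 ≤
      (hermiteKernel N x x - hermiteKernel M x x) *
        (hermiteKernel N y y - hermiteKernel M y y) := by
  have e : ∀ x y, hermiteKernel N x y - hermiteKernel M x y = ∑ k ∈ Finset.Ico M N,
      (hermiteFun k x / √(k.factorial : ℝ)) * (hermiteFun k y / √(k.factorial : ℝ)) := fun x y => by
    rw [hermiteKernel, hermiteKernel, ← Finset.sum_Ico_eq_sub _ h]
    refine Finset.sum_congr rfl fun k _ => ?_
    rw [div_mul_div_comm, Real.mul_self_sqrt (Nat.cast_nonneg _)]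
  rw [e, e, e]
  simpa only [sq] using Finset.sum_mul_sq_le_sq_mul_sq (Finset.Ico M N)
    (fun k => hermiteFun k x / √(k.factorial : ℝ)) (fun k => hermiteFun k y / √(k.factorial : ℝ))

theorem tendsto_sub_bulkPoint_sq {ξ : ℝ} (hξ : ξ ∈ Set.Ioo (-2 : ℝ) 2) (t c : ℝ) :
    Tendsto (fun N : ℕ => (N : ℝ) - c - bulkPoint ξ N t ^ 2 / 4) atTop atTop := by
  have h1 : Tendsto (fun N : ℕ => (N : ℝ) * (1 - ξ ^ 2 / 4)) atTop atTop :=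
    tendsto_natCast_atTop_atTop.atTop_mul_const (by nlinarith [hξ.1, hξ.2])
  have h2 : Tendsto (fun N : ℕ => -c - ξ * t / 2 - t ^ 2 / 4 / (N : ℝ)) atTop
      (𝓝 (-c - ξ * t / 2 - 0)) := (tendsto_const_div_atTop_nhds_zero_nat _).const_sub _
  refine (h1.atTop_add h2).congr' ?_
  filter_upwards [eventually_gt_atTop 0] with N hN
  have h0 : √(N : ℝ) ≠ 0 := (Real.sqrt_pos.2 (Nat.cast_pos.2 hN)).ne'
  have hs : √(N : ℝ) ^ 2 = N := Real.sq_sqrt N.cast_nonneg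
  have : bulkPoint ξ N t ^ 2 = √(N : ℝ) ^ 2 * ξ ^ 2 + 2 * ξ * t + t ^ 2 / √(N : ℝ) ^ 2 := by
    rw [bulkPoint]
    field_simp
    ring
  rw [this, hs]
  ring

/-- Each lowering removes one term of the kernel, whose share is at most `1 / (N - j - x² / 4)`. In
the bulk this denominator grows linearly in `N`. -/
theorem tendsto_kernelRatio_self_sub {ξ : ℝ} (hξ : ξ ∈ Set.Ioo (-2 : ℝ) 2) (t : ℝ) (j : ℕ) :
    Tendsto (fun N => kernelRatio ξ (N - j) N t t) atTop (𝓝 1) := by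
  induction j with
  | zero => simpa using tendsto_kernelRatio hξ t t
  | succ j ih =>
    have hlim := tendsto_sub_bulkPoint_sq hξ t j
    have h0 : Tendsto (fun N => kernelRatio ξ (N - j) N t t - kernelRatio ξ (N - (j + 1)) N t t)
        atTop (𝓝 0) := by
      refine squeeze_zero' ?_ ?_ hlim.inv_tendsto_atTop
      · refine Eventually.of_forall fun N => ?_
        rw [kernelRatio, kernelRatio, ← sub_div]
        refine div_nonneg (sub_nonneg.2 (hermiteKernel_mono _ (by omega))) (by positivity)
      · filter_upwards [eventually_gt_atTop j, hlim.eventually_gt_atTop 0] with N hN hpos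
        obtain ⟨n, rfl⟩ : ∃ n, N = n + 1 + j := ⟨N - j - 1, by omega⟩
        have hK := one_le_hermiteKernel_self (show 0 < n + 1 + j by omega)
          (bulkPoint ξ (n + 1 + j) t)
        have hle := (sq_hermiteFun_le n (bulkPoint ξ (n + 1 + j) t)).trans
          (hermiteKernel_mono (bulkPoint ξ (n + 1 + j) t) (show n + 1 ≤ n + 1 + j by omega))
        rw [Pi.inv_apply]
        push_cast at hpos ⊢
        rw [add_sub_cancel_right] at hpos ⊢
        rw [show n + 1 + j - j = n + 1 by omega, show n + 1 + j - (j + 1) = n by omega,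
          kernelRatio, kernelRatio, Real.mul_self_sqrt (by linarith), ← sub_div,
          hermiteKernel_succ, add_sub_cancel_left, div_le_iff₀ (by linarith), inv_mul_eq_div,
          le_div_iff₀ hpos, ← sq, mul_comm]
        exact hle
    simpa using ih.sub h0

theorem abs_kernelRatio_le_one (ξ : ℝ) {M N : ℕ} (h : M ≤ N) (t s : ℝ) :
    |kernelRatio ξ M N t s| ≤ 1 := by
  have h0 : ∀ n x, 0 ≤ hermiteKernel n x x := fun n x => by
    simpa [hermiteKernel_zero] using hermiteKernel_mono x n.zero_le
  have h1 := sq_hermiteKernel_sub_le M.zero_le (bulkPoint ξ N t) (bulkPoint ξ N s)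
  simp only [hermiteKernel_zero, sub_zero] at h1
  rw [kernelRatio, abs_div]
  refine div_le_one_of_le₀ ?_ (abs_nonneg _)
  rw [← Real.sqrt_mul (h0 _ _), abs_of_nonneg (Real.sqrt_nonneg _)]
  refine Real.abs_le_sqrt (h1.trans ?_)
  exact mul_le_mul (hermiteKernel_mono _ h) (hermiteKernel_mono _ h) (h0 _ _) (h0 _ _)

/-- Cauchy–Schwarz for the removed terms transfers the stability from the diagonal to all pairs of
points. -/
theorem sq_kernelRatio_sub_le (ξ : ℝ) {M N : ℕ} (h : M ≤ N) (hN : 0 < N) (t s : ℝ) :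
    (kernelRatio ξ N N t s - kernelRatio ξ M N t s) ^ 2 ≤
      (1 - kernelRatio ξ M N t t) * (1 - kernelRatio ξ M N s s) := by
  have ht := one_le_hermiteKernel_self hN (bulkPoint ξ N t)
  have hs := one_le_hermiteKernel_self hN (bulkPoint ξ N s)
  rw [← kernelRatio_self (ξ := ξ) hN t]
  nth_rw 2 [kernelRatio_self hN t]
  rw [← kernelRatio_self (ξ := ξ) hN s]
  simp only [kernelRatio, ← sub_div]
  rw [Real.mul_self_sqrt (by linarith), Real.mul_self_sqrt (by linarith), div_pow, mul_pow,
    Real.sq_sqrt (by linarith), Real.sq_sqrt (by linarith), div_mul_div_comm]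
  gcongr
  exact sq_hermiteKernel_sub_le h _ _

theorem tendsto_kernelRatio_sub {ξ : ℝ} (hξ : ξ ∈ Set.Ioo (-2 : ℝ) 2) (t s : ℝ) (j : ℕ) :
    Tendsto (fun N => kernelRatio ξ (N - j) N t s) atTop
      (𝓝 (Real.sinc (bulkFreq ξ * (t - s)))) := by
  have h0 : Tendsto (fun N => kernelRatio ξ N N t s - kernelRatio ξ (N - j) N t s) atTop
      (𝓝 0) := by
    have h1 := (((tendsto_kernelRatio_self_sub hξ t j).const_sub 1).mul
      ((tendsto_kernelRatio_self_sub hξ s j).const_sub 1)).sqrt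
    rw [sub_self, mul_zero, Real.sqrt_zero] at h1
    refine squeeze_zero_norm' ?_ h1
    filter_upwards [eventually_gt_atTop 0] with N hN
    exact Real.abs_le_sqrt (sq_kernelRatio_sub_le ξ (Nat.sub_le N j) hN t s)
  simpa using (tendsto_kernelRatio hξ s t).sub h0

/-! ### Asymptotics of the covariance -/

/-- The covariance of two characteristic polynomials. -/
noncomputable def detCov (γ : ℝ) (N : ℕ) (x y : ℝ) : ℝ :=
  detCorr γ N x y - hermiteFun N x * hermiteFun N y

/-- For `m = 0` the truncated `2 * m - 1` is `0`, giving `K_N`: the product of the means is the last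
term of `K_{N+1}`. For `m ≥ 1` nothing changes. The series is a finite sum, written with a range
free of `N` for dominated convergence. -/
theorem detCov_eq_tsum (γ : ℝ) (N : ℕ) (x y : ℝ) : detCov γ N x y =
    N.factorial * ∑' m : ℕ, γ ^ m / m.factorial * hermiteKernel (N - (2 * m - 1)) x y := by
  rw [tsum_eq_sum (s := Finset.range (N + 1)) fun m hm => ?_, detCov, detCorr,
    Finset.sum_range_succ', Finset.sum_range_succ', mul_add, mul_add]
  · have hf : (N.factorial : ℝ) ≠ 0 := Nat.cast_ne_zero.2 N.factorial_ne_zero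
    simp only [mul_zero, zero_tsub, tsub_zero, pow_zero, Nat.factorial_zero, Nat.cast_one,
      div_one, one_mul, hermiteKernel_succ]
    rw [mul_add, mul_div_cancel₀ _ hf]
    have : ∀ m, N + 1 - 2 * (m + 1) = N - (2 * (m + 1) - 1) := fun m => by omega
    simp only [this]
    ring
  · rw [Finset.mem_range, not_lt] at hm
    rw [show N - (2 * m - 1) = 0 by omega, hermiteKernel_zero, mul_zero]

/-- For each `m` the index is lowered by a fixed amount, so all kernel ratios have the same limit.
They are at most `1` in absolute value, which makes the exponential series of `|γ|` a dominating
one. -/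
theorem tendsto_detCov_div {ξ : ℝ} (hξ : ξ ∈ Set.Ioo (-2 : ℝ) 2) (γ t s : ℝ) :
    Tendsto (fun N : ℕ => detCov γ N (bulkPoint ξ N t) (bulkPoint ξ N s) / (N.factorial *
      (√(hermiteKernel N (bulkPoint ξ N t) (bulkPoint ξ N t)) *
        √(hermiteKernel N (bulkPoint ξ N s) (bulkPoint ξ N s))))) atTop
      (𝓝 (Real.exp γ * Real.sinc (bulkFreq ξ * (t - s)))) := by
  have h := tendsto_tsum_of_dominated_convergence
    (f := fun N m => γ ^ m / m.factorial * kernelRatio ξ (N - (2 * m - 1)) N t s)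
    (g := fun m => γ ^ m / m.factorial * Real.sinc (bulkFreq ξ * (t - s))) (𝓕 := atTop)
    (bound := fun m => |γ| ^ m / m.factorial) (Real.summable_pow_div_factorial |γ|)
    (fun m => (tendsto_kernelRatio_sub hξ t s (2 * m - 1)).const_mul _)
    (Eventually.of_forall fun N m => ?_)
  · rw [tsum_mul_right] at h
    have he : ∑' m : ℕ, γ ^ m / m.factorial = Real.exp γ := by
      rw [Real.exp_eq_exp_ℝ, NormedSpace.exp_eq_tsum_div]
    rw [he] at h
    refine h.congr fun N => ?_
    have hf : (N.factorial : ℝ) ≠ 0 := Nat.cast_ne_zero.2 N.factorial_ne_zero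
    rw [detCov_eq_tsum, mul_div_mul_left _ _ hf, ← tsum_div_const]
    simp only [kernelRatio, mul_div_assoc']
  · rw [norm_mul, norm_div, norm_pow, Real.norm_eq_abs, Real.norm_natCast]
    exact mul_le_of_le_one_right (by positivity) (abs_kernelRatio_le_one ξ (Nat.sub_le _ _) t s)

theorem eventually_detCov_self_pos {ξ : ℝ} (hξ : ξ ∈ Set.Ioo (-2 : ℝ) 2) (γ t : ℝ) :
    ∀ᶠ N : ℕ in atTop, 0 < detCov γ N (bulkPoint ξ N t) (bulkPoint ξ N t) := by
  have h := tendsto_detCov_div hξ γ t t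
  rw [sub_self, mul_zero, Real.sinc_zero, mul_one] at h
  filter_upwards [h.eventually (lt_mem_nhds (Real.exp_pos γ))] with N hN
  by_contra! hc
  exact absurd hN (not_lt.2 (div_nonpos_of_nonpos_of_nonneg hc (by positivity)))

theorem tendsto_detCov_correlation {ξ : ℝ} (hξ : ξ ∈ Set.Ioo (-2 : ℝ) 2) (γ t s : ℝ) :
    Tendsto (fun N : ℕ => detCov γ N (bulkPoint ξ N t) (bulkPoint ξ N s) /
      (√(detCov γ N (bulkPoint ξ N t) (bulkPoint ξ N t)) *
        √(detCov γ N (bulkPoint ξ N s) (bulkPoint ξ N s)))) atTop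
      (𝓝 (Real.sinc (bulkFreq ξ * (t - s)))) := by
  have hself := fun t => tendsto_detCov_div hξ γ t t
  simp only [sub_self, mul_zero, Real.sinc_zero, mul_one] at hself
  have hexp : √(Real.exp γ) * √(Real.exp γ) = Real.exp γ := Real.mul_self_sqrt (Real.exp_pos γ).le
  have h := (tendsto_detCov_div hξ γ t s).div ((hself t).sqrt.mul (hself s).sqrt)
    (by rw [hexp]; exact (Real.exp_pos γ).ne')
  rw [hexp, mul_div_cancel_left₀ _ (Real.exp_pos γ).ne'] at h
  refine h.congr' ?_
  filter_upwards [eventually_gt_atTop 0] with N hN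
  have ht := one_le_hermiteKernel_self hN (bulkPoint ξ N t)
  have hs := one_le_hermiteKernel_self hN (bulkPoint ξ N s)
  have hf : (0 : ℝ) < N.factorial := Nat.cast_pos.2 N.factorial_pos
  rw [Pi.div_apply, Real.mul_self_sqrt (by linarith), Real.mul_self_sqrt (by linarith),
    Real.sqrt_div' _ (by positivity), Real.sqrt_div' _ (by positivity), Real.sqrt_mul hf.le,
    Real.sqrt_mul hf.le]
  have e := Real.mul_self_sqrt hf.le
  have hf' := Real.sqrt_pos.2 hf
  have ht' := Real.sqrt_pos.2 (show 0 < hermiteKernel N (bulkPoint ξ N t) (bulkPoint ξ N t) by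
    linarith)
  have hs' := Real.sqrt_pos.2 (show 0 < hermiteKernel N (bulkPoint ξ N s) (bulkPoint ξ N s) by
    linarith)
  rw [← mul_div_mul_comm, div_div_div_eq]
  generalize √(hermiteKernel N (bulkPoint ξ N t) (bulkPoint ξ N t)) = a at *
  generalize √(hermiteKernel N (bulkPoint ξ N s) (bulkPoint ξ N s)) = b at *
  generalize √(N.factorial : ℝ) = c at *
  rw [← e, show c * a * (c * b) = c * c * (a * b) by ring, mul_comm (c * c * (a * b)),
    mul_div_mul_right _ _ (by positivity)]

/-! ### Return to the characteristic polynomial of the Wigner matrix -/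

theorem spectralPoint_eq_bulkPoint (N : ℕ) (ξ η : ℝ) :
    spectralPoint N ξ η = bulkPoint ξ N (η / semicircleDensity ξ) := by
  rw [spectralPoint, bulkPoint, div_div, mul_comm (semicircleDensity ξ)]

/-- The semicircle density is the local frequency divided by `π`, so measuring distances in mean
spacings makes the limit independent of `ξ`. -/
theorem bulkFreq_mul_sub {ξ : ℝ} (hξ : ξ ∈ Set.Ioo (-2 : ℝ) 2) (μ ν : ℝ) :
    bulkFreq ξ * (μ / semicircleDensity ξ - ν / semicircleDensity ξ) = Real.pi * (μ - ν) := by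
  have h := bulkFreq_pos hξ
  have h1 : semicircleDensity ξ = bulkFreq ξ / Real.pi := by
    rw [semicircleDensity, bulkFreq]
    field_simp
  rw [h1, ← sub_div]
  have := Real.pi_pos
  field_simp

theorem IsWignerArray.ofReal_charDet {Ω : Type*} [MeasurableSpace Ω]
    {P : Measure Ω} {Q : Measure ℝ} {X : ℕ → ℕ → Ω → ℂ} (hX : IsWignerArray Q P X)
    (N : ℕ) (ξ η : ℝ) (ω : Ω) :
    ((charDet X N ξ η ω : ℝ) : ℂ) =
      (shiftedMatrix X (fun i : Fin N => (i : ℕ)) (fun i => i) (spectralPoint N ξ η) ω).det := by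
  rw [charDet_eq_det hX, shiftedMatrix_self X Fin.val_injective]
  rfl

section

variable {Ω : Type*} [MeasurableSpace Ω] {P : Measure Ω} [IsProbabilityMeasure P] {Q : Measure ℝ}
  {X : ℕ → ℕ → Ω → ℂ}

theorem IsWignerArray.memLp_charDet (hX : IsWignerArray Q P X) (hQ : WignerMoments Q)
    (N : ℕ) (ξ η : ℝ) : MemLp (charDet X N ξ η) 2 P := by
  have h := (hX.memLp_det hQ (e := fun i : Fin N => (i : ℕ)) Fin.val_injective
    (spectralPoint N ξ η)).re
  refine (memLp_congr_ae (ae_of_all _ fun ω => ?_)).1 h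
  rw [← hX.ofReal_charDet]
  exact Complex.ofReal_re _

theorem IsWignerArray.integral_charDet (hX : IsWignerArray Q P X) (hQ : WignerMoments Q)
    (N : ℕ) (ξ η : ℝ) :
    ∫ ω, charDet X N ξ η ω ∂P = (-1) ^ N * hermiteFun N (spectralPoint N ξ η) := by
  have h := hX.integral_det hQ N (e := fun i : Fin N => (i : ℕ)) Fin.val_injective
    (spectralPoint N ξ η)
  simp only [← hX.ofReal_charDet, integral_complex_ofReal] at h
  exact_mod_cast h

theorem IsWignerArray.integral_centeredCharDet_mul (hX : IsWignerArray Q P X)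
    (hQ : WignerMoments Q) (N : ℕ) (ξ μ ν : ℝ) :
    ∫ ω, centeredCharDet P X N ξ μ ω * centeredCharDet P X N ξ ν ω ∂P =
      detCov (excess Q) N (spectralPoint N ξ μ) (spectralPoint N ξ ν) := by
  have hμ := hX.memLp_charDet hQ N ξ μ
  have hν := hX.memLp_charDet hQ N ξ ν
  have h := hX.integral_det_mul_det hQ N (e := fun i : Fin N => (i : ℕ)) Fin.val_injective
    (spectralPoint N ξ μ) (spectralPoint N ξ ν)
  simp only [← hX.ofReal_charDet, ← Complex.ofReal_mul, integral_complex_ofReal] at h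
  have h' := Complex.ofReal_injective h
  have hcov := covariance_eq_sub hμ hν
  rw [covariance] at hcov
  have hsq : ((-1 : ℝ) ^ N) * (-1) ^ N = 1 := by rw [← mul_pow]; norm_num
  simp only [centeredCharDet]
  rw [hcov, hX.integral_charDet hQ, hX.integral_charDet hQ, detCov]
  simp only [Pi.mul_apply]
  rw [h']
  linear_combination (-hermiteFun N (spectralPoint N ξ μ) * hermiteFun N (spectralPoint N ξ ν)) *
    hsq

end

theorem corollary2 {Ω : Type*} [MeasurableSpace Ω] (P : Measure Ω) [IsProbabilityMeasure P]
    (Q : Measure ℝ) [IsProbabilityMeasure Q] (hQ : WignerMoments Q)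
    (X : ℕ → ℕ → Ω → ℂ) (hX : IsWignerArray Q P X)
    (ξ : ℝ) (hξ : ξ ∈ Set.Ioo (-2 : ℝ) 2) (μ ν : ℝ) :
    (∀ N : ℕ, MemLp (charDet X N ξ μ) 2 P ∧ MemLp (charDet X N ξ ν) 2 P) ∧
    (∀ᶠ N : ℕ in atTop, 0 < ∫ ω, centeredCharDet P X N ξ μ ω ^ 2 ∂P ∧
      0 < ∫ ω, centeredCharDet P X N ξ ν ω ^ 2 ∂P) ∧
    Tendsto (fun N : ℕ =>
        (∫ ω, centeredCharDet P X N ξ μ ω * centeredCharDet P X N ξ ν ω ∂P) /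
          (√(∫ ω, centeredCharDet P X N ξ μ ω ^ 2 ∂P) *
            √(∫ ω, centeredCharDet P X N ξ ν ω ^ 2 ∂P)))
      atTop (𝓝 (Real.sinc (Real.pi * (μ - ν)))) := by
  simp only [sq, hX.integral_centeredCharDet_mul hQ, spectralPoint_eq_bulkPoint]
  refine ⟨fun N => ⟨hX.memLp_charDet hQ N ξ μ, hX.memLp_charDet hQ N ξ ν⟩,
    (eventually_detCov_self_pos hξ _ _).and (eventually_detCov_self_pos hξ _ _), ?_⟩
  rw [← bulkFreq_mul_sub hξ μ ν]
  exact tendsto_detCov_correlation hξ _ _ _
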